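/- Let $\mathbf G=(G,W)$ be an infinite, countable, undirected weighted graph of bounded degree: $W=(W_{ij})_{i,j\in G}$ is a real symmetric matrix, $\deg(\mathbf G):=\max_i \#\{j: W_{ij}\neq 0\}<\infty$, and $W$ is normalized so that $|W_{ij}|\le 1/\deg(\mathbf G)$. Then $W$ acts on $\ell^2(G)$ as a bounded self-adjoint operator with norm at most $1$; let $\mathrm{Sp}(W)\subset\mathbb R$ be its spectrum, $I$ the convex hull of $\mathrm{Sp}(W)$, $E$ its resolution of the identity, and $\mu_{ij}(\omega)=\langle E(\omega)\delta_i,\delta_j\rangle$ for $i,j\in G$ and Borel sets $\omega$. For a continuous $f$ on $\mathrm{Sp}(W)$ put $\mathcal K(f)=f(W)=\int f\,dE$. Let $G_0\subset G_1\subset\cdots$ be finite subsets of $G$ with $m_n=\#G_n\to\infty$, let $\delta_n=\#\{i\in G_n:\exists j\in G\setminus G_n,\ W_{ij}\ne0\}$, and for a function $f$ let $\mathcal K_n(f)=(\mathcal K(f)_{ij})_{i,j\in G_n}$. Assume 1. $\delta_n=o(m_n)$; 2. there is a finite positive measure $\mu$ on $\mathbb R$ such that $\frac1{m_n}\sum_{i\in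 G_n}\mu_{ii}\to\mu$ weakly. Let $\Theta=[a,b]\subset\mathbb R$ be a compact interval, $\rho>0$, and let $(f_\theta)_{\theta\in\Theta}$ be a family of functions such that 3. (a) $\theta\mapsto f_\theta$ is injective modulo $\mu$-null sets, that is, $f_\theta=f_{\theta'}$ $\mu$-almost everywhere implies $\theta=\theta'$; (b) $\theta\mapsto f_\theta(\lambda)$ is continuous on $\Theta$ for every $\lambda\in\mathrm{Sp}(W)$; (c) each $f_\theta$ is a positive analytic function on $I$ with $\alpha(\log f_\theta)\le\rho$, that is, $\log f_\theta(x)=\sum_{k\ge0}c_kx^k$ on $I$ with $\sum_{k\ge 0}(k+1)|c_k|\le\rho$. Let $\theta_0$ be an interior point of $\Theta$ and let $X=(X_i)_{i\in G}$ be a centered Gaussian process with covariance $\mathrm{Cov}(X_i,X_j)=\mathcal K(f_{\theta_0})_{ij}$, with law denoted $P_{f_{\theta_0}}$; write $X_n=(X_i)_{i\in G_n}$. Define $$L_n(\theta)=-\tfrac12\big(m_n\log(2\pi)+\log\det\mathcal K_n(f_\theta)+X_n^T\mathcal K_n(f_\theta)^{-1}X_n\big),$$ $$\bar L_n(\theta)=-\tfrac12\Big(m_n\log(2\pi)+m_n\int\log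 f_\theta\,d\mu+X_n^T\mathcal K_n(f_\theta)^{-1}X_n\Big),$$ $$\tilde L_n(\theta)=-\tfrac12\Big(m_n\log(2\pi)+m_n\int\log f_\theta\,d\mu+X_n^T\mathcal K_n(1/f_\theta)X_n\Big).$$ Then each of these functions has a maximizer on $\Theta$, and any sequences of maximizers $\hat\theta_n$ of $L_n$, $\bar\theta_n$ of $\bar L_n$ and $\tilde\theta_n$ of $\tilde L_n$ over $\Theta$ converge to $\theta_0$, $P_{f_{\theta_0}}$-almost surely. Let moreover $P\ge1$ be an integer and, for $i,j\in G_n$, let $$B^{(n)}_{ij}=\frac{\#\{(k,l)\in G_n\times G:\mu_{kl}=\mu_{ij}\}}{\#\{(k,l)\in G_n\times G_n:\mu_{kl}=\mu_{ij}\}}$$ if the graph distance of $i$ and $j$ in $\mathbf G$ is at most $P$, and $B^{(n)}_{ij}=1$ otherwise. If there is a positive sequence $u_n\to0$ with $\sup_{i,j\in G_n}|B^{(n)}_{ij}-1|\le u_n$ for all $n$, then the same conclusion holds for the maximizers $\theta^{(u)}_n$ over $\Theta$ of $$L^{(u)}_n(\theta)=-\tfrac12\Big(m_n\log(2\pi)+m_n\int\log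 f_\theta\,d\mu+X_n^T\big(B^{(n)}\odot\mathcal K_n(1/f_\theta)\big)X_n\Big),$$ where $\odot$ is the entrywise product of matrices. -/

import Mathlib

open Filter Topology MeasureTheory ProbabilityTheory
open scoped Matrix ENNReal NNReal CompactlySupported

noncomputable section

/-! ### Scalar spectral measures of a bounded self-adjoint operator -/

section SpectralMeasure

variable {H : Type*} [NormedAddCommGroup H] [InnerProductSpace ℂ H] [CompleteSpace H]

/-- The operator `f(A) = ∫ f(λ) dE(λ)` for a self-adjoint operator `A` with resolution of the
identity `E`, and a function `f` continuous on the spectrum of `A`. -/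
def operatorFunction (A : H →L[ℂ] H) (f : ℝ → ℝ) : H →L[ℂ] H := cfc f A

/-- For a self-adjoint operator `A` and a vector `v`, the positive functional
`g ↦ ⟨g(A) v, v⟩` on the continuous functions on the (compact) spectrum of `A`. -/
def spectralFunctional (A : H →L[ℂ] H) (hA : IsSelfAdjoint A) (v : H) :
    C_c(spectrum ℝ A, ℝ) →ₚ[ℝ] ℝ :=
  PositiveLinearMap.mk₀
    { toFun := fun g => (inner ℂ v (cfcHom (R := ℝ) hA g.toContinuousMap v)).re
      map_add' := fun g h => by
        have : (g + h).toContinuousMap = g.toContinuousMap + h.toContinuousMap := rfl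
        rw [this, map_add]
        simp
      map_smul' := fun c g => by
        have : (c • g).toContinuousMap = c • g.toContinuousMap := rfl
        rw [this, map_smul]
        simp [inner_smul_right_eq_smul] }
    (fun g hg => by
      have h0 : (0 : H →L[ℂ] H) ≤ cfcHom (R := ℝ) hA g.toContinuousMap :=
        cfcHom_nonneg_iff hA |>.2 fun x => hg x
      have := (ContinuousLinearMap.nonneg_iff_isPositive _).1 h0
      simpa using (Complex.le_def.1 (this.inner_nonneg_right v)).1)

/-- The spectral measure `ω ↦ ⟨E(ω) v, v⟩` of `A` at `v`, where `E` is the resolution of the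
identity of `A`: the measure on the spectrum (seen as a measure on `ℝ`) which represents
`g ↦ ⟨g(A) v, v⟩`. -/
def spectralMeasure (A : H →L[ℂ] H) (hA : IsSelfAdjoint A) (v : H) : Measure ℝ :=
  (RealRMK.rieszMeasure (spectralFunctional A hA v)).map Subtype.val

instance (A : H →L[ℂ] H) (hA : IsSelfAdjoint A) (v : H) :
    IsFiniteMeasure (spectralMeasure A hA v) := by
  unfold spectralMeasure
  infer_instance

end SpectralMeasure

/-! ### Weighted graphs and their adjacency operator -/

/-- An undirected weighted graph of bounded degree with vertex set `G`, with renormalized weights: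
the entries of the symmetric adjacency operator `W` lie in `[-1/deg, 1/deg]`, where `deg` is the
maximal number of neighbours of a vertex. -/
structure WeightedGraph (G : Type*) where
  W : G → G → ℝ
  symm : ∀ i j, W i j = W j i
  finite_neighbors : ∀ i, {j | W i j ≠ 0}.Finite
  bddAbove_degree : BddAbove (Set.range fun i => {j | W i j ≠ 0}.ncard)
  abs_le : ∀ i j, |W i j| ≤ 1 / ((⨆ i, {j | W i j ≠ 0}.ncard : ℕ) : ℝ)

namespace WeightedGraph

variable {G : Type*} (Γ : WeightedGraph G)

theorem summable_abs (i : G) : Summable fun j => |Γ.W i j| :=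
  summable_of_hasFiniteSupport <| (Γ.finite_neighbors i).subset fun j hj => by
    simpa using hj

theorem tsum_abs_le_one (i : G) : ∑' j, |Γ.W i j| ≤ 1 := by
  classical
  set D : ℕ := ⨆ i, {j | Γ.W i j ≠ 0}.ncard with hD
  have hi : {j | Γ.W i j ≠ 0}.ncard ≤ D := le_ciSup Γ.bddAbove_degree i
  rw [tsum_eq_sum (s := (Γ.finite_neighbors i).toFinset) (fun j hj => by simpa using hj)]
  calc ∑ j ∈ (Γ.finite_neighbors i).toFinset, |Γ.W i j|
      ≤ ∑ _j ∈ (Γ.finite_neighbors i).toFinset, 1 / (D : ℝ) :=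
        Finset.sum_le_sum fun j _ => Γ.abs_le i j
    _ = ({j | Γ.W i j ≠ 0}.ncard : ℝ) * (1 / (D : ℝ)) := by
        rw [Finset.sum_const, nsmul_eq_mul, Set.ncard_eq_toFinset_card _ (Γ.finite_neighbors i)]
    _ ≤ (D : ℝ) * (1 / (D : ℝ)) := by gcongr
    _ ≤ 1 := by
        rw [mul_one_div]
        exact div_self_le_one _

theorem summable_mul (u : G → ℂ) (i : G) : Summable fun j => (Γ.W i j : ℂ) * u j :=
  summable_of_hasFiniteSupport <| (Γ.finite_neighbors i).subset fun j hj => by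
    simp only [Function.mem_support, ne_eq, mul_eq_zero, not_or] at hj
    simpa using hj.1

theorem norm_sq_tsum_le (u : G → ℂ) (i : G) :
    ‖∑' j, (Γ.W i j : ℂ) * u j‖ ^ 2 ≤ ∑' j, |Γ.W i j| * ‖u j‖ ^ 2 := by
  classical
  set s := (Γ.finite_neighbors i).toFinset with hs
  have hz : ∀ j ∉ s, Γ.W i j = 0 := fun j hj => by simpa [hs] using hj
  have h1 : ∑ j ∈ s, |Γ.W i j| ≤ 1 := by
    exact ((Γ.summable_abs i).sum_le_tsum s fun _ _ => abs_nonneg _).trans (Γ.tsum_abs_le_one i)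
  rw [tsum_eq_sum (s := s) (fun j hj => by simp [hz j hj]),
    tsum_eq_sum (s := s) (fun j hj => by simp [hz j hj])]
  calc ‖∑ j ∈ s, (Γ.W i j : ℂ) * u j‖ ^ 2
      ≤ (∑ j ∈ s, |Γ.W i j| * ‖u j‖) ^ 2 := by
        gcongr
        refine (norm_sum_le _ _).trans (le_of_eq ?_)
        simp
    _ ≤ (∑ j ∈ s, |Γ.W i j|) * ∑ j ∈ s, |Γ.W i j| * ‖u j‖ ^ 2 := by
        refine Finset.sum_sq_le_sum_mul_sum_of_sq_le_mul s (fun j _ => abs_nonneg _)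
          (fun j _ => by positivity) fun j _ => le_of_eq (by ring)
    _ ≤ 1 * ∑ j ∈ s, |Γ.W i j| * ‖u j‖ ^ 2 := by
        gcongr
    _ = _ := one_mul _

theorem sum_norm_sq_le (u : lp (fun _ : G => ℂ) 2) (s : Finset G) :
    ∑ i ∈ s, ‖∑' j, (Γ.W i j : ℂ) * u j‖ ^ 2 ≤ ‖u‖ ^ 2 := by
  classical
  have hu : HasSum (fun j => ‖u j‖ ^ 2) (‖u‖ ^ 2) := by
    simpa using lp.hasSum_norm (p := 2) (by norm_num) u
  have hsum : ∀ i, Summable fun j => |Γ.W i j| * ‖u j‖ ^ 2 := fun i =>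
    summable_of_hasFiniteSupport <| (Γ.finite_neighbors i).subset fun j hj => by
      simp only [Function.mem_support, ne_eq, mul_eq_zero, not_or, abs_eq_zero] at hj
      simpa using hj.1
  calc ∑ i ∈ s, ‖∑' j, (Γ.W i j : ℂ) * u j‖ ^ 2
      ≤ ∑ i ∈ s, ∑' j, |Γ.W i j| * ‖u j‖ ^ 2 :=
        Finset.sum_le_sum fun i _ => Γ.norm_sq_tsum_le u i
    _ = ∑' j, ∑ i ∈ s, |Γ.W i j| * ‖u j‖ ^ 2 := (Summable.tsum_finsetSum fun i _ => hsum i).symm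
    _ ≤ ∑' j, ‖u j‖ ^ 2 := by
        refine Summable.tsum_le_tsum (fun j => ?_) (summable_sum fun i _ => hsum i) hu.summable
        rw [← Finset.sum_mul]
        refine mul_le_of_le_one_left (by positivity) ?_
        calc ∑ i ∈ s, |Γ.W i j| = ∑ i ∈ s, |Γ.W j i| := by simp_rw [Γ.symm _ j]
          _ ≤ ∑' i, |Γ.W j i| := (Γ.summable_abs j).sum_le_tsum s fun _ _ => abs_nonneg _
          _ ≤ 1 := Γ.tsum_abs_le_one j
    _ = ‖u‖ ^ 2 := hu.tsum_eq

theorem memℓp_mul (u : lp (fun _ : G => ℂ) 2) :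
    Memℓp (fun i => ∑' j, (Γ.W i j : ℂ) * u j) 2 :=
  memℓp_gen' (C := ‖u‖ ^ 2) fun s => by simpa using Γ.sum_norm_sq_le u s

/-- The adjacency operator `(W u)_i = ∑_j W_ij u_j` on `ℓ²(G)`. (Complex scalars are used so that
the functional calculus is available; all matrix entries below are real.) -/
def op : lp (fun _ : G => ℂ) 2 →L[ℂ] lp (fun _ : G => ℂ) 2 :=
  LinearMap.mkContinuous
    { toFun := fun u => ⟨fun i => ∑' j, (Γ.W i j : ℂ) * u j, Γ.memℓp_mul u⟩
      map_add' := fun u v => by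
        ext i
        simp only [lp.coeFn_add, Pi.add_apply, mul_add]
        exact (Γ.summable_mul u i).tsum_add (Γ.summable_mul v i)
      map_smul' := fun c u => by
        ext i
        simp only [lp.coeFn_smul, Pi.smul_apply, smul_eq_mul, RingHom.id_apply, mul_left_comm _ c]
        exact tsum_mul_left }
    1 fun u => by
      rw [one_mul]
      refine lp.norm_le_of_forall_sum_le (p := 2) (by norm_num) (norm_nonneg u) fun s => ?_
      simpa using Γ.sum_norm_sq_le u s

theorem op_apply (u : lp (fun _ : G => ℂ) 2) (i : G) :
    Γ.op u i = ∑' j, (Γ.W i j : ℂ) * u j := rfl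

/-- The sequence `δ_i = (1_{k = i})_k` of `ℓ²(G)`. -/
def delta (i : G) : lp (fun _ : G => ℂ) 2 :=
  letI := Classical.decEq G
  lp.single 2 i (1 : ℂ)

theorem inner_delta (i : G) (u : lp (fun _ : G => ℂ) 2) : inner ℂ (delta i) u = u i := by
  classical
  rw [delta, Subsingleton.elim (Classical.decEq G) (fun a b => Classical.propDecidable (a = b))]
  rw [lp.inner_single_left]
  simp

theorem op_delta_apply (i j : G) : Γ.op (delta i) j = Γ.W j i := by
  classical
  rw [op_apply, tsum_eq_single i]
  · simp [delta]
  · intro k hk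
    simp [delta, hk]

theorem isSelfAdjoint_op : IsSelfAdjoint Γ.op := by
  rw [ContinuousLinearMap.isSelfAdjoint_iff']
  ext u i
  rw [← inner_delta, ContinuousLinearMap.adjoint_inner_right, lp.inner_eq_tsum, op_apply]
  refine tsum_congr fun j => ?_
  rw [op_delta_apply, Γ.symm j i]
  simp [mul_comm]

/-- The spectrum of the adjacency operator. -/
def Sp : Set ℝ := spectrum ℝ Γ.op

/-- The convex hull of the spectrum of the adjacency operator. -/
def hull : Set ℝ := convexHull ℝ Γ.Sp

/-- The entry `(i, j)` of the operator `𝒦(f) = f(W) = ∫ f(λ) dE(λ)`. -/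
def K (f : ℝ → ℝ) (i j : G) : ℝ := (inner ℂ (delta i) (operatorFunction Γ.op f (delta j))).re

/-- The matrix `𝒦_n(f)`: the restriction of `𝒦(f)` to a finite set of vertices. -/
def Kmat (S : Finset G) (f : ℝ → ℝ) : Matrix S S ℝ := Matrix.of fun i j => Γ.K f i j

/-- The diagonal spectral measure `μ_ii`. -/
def diagMeasure (i : G) : FiniteMeasure ℝ :=
  ⟨spectralMeasure Γ.op Γ.isSelfAdjoint_op (delta i), inferInstance⟩

/-- The averaged diagonal spectral measure `(1/m) ∑_{i ∈ S} μ_ii`, with `m` the cardinality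
of `S`. -/
def avgMeasure (S : Finset G) : FiniteMeasure ℝ :=
  (S.card : ℝ≥0)⁻¹ • ∑ i ∈ S, Γ.diagMeasure i

/-- The real measure `μ_ij(ω) = ⟨E(ω) δ_i, δ_j⟩`, obtained from spectral measures of vectors by
polarization. -/
def pairMeasure (i j : G) : SignedMeasure ℝ :=
  (1 / 4 : ℝ) •
    ((spectralMeasure Γ.op Γ.isSelfAdjoint_op (delta i + delta j)).toSignedMeasure -
      (spectralMeasure Γ.op Γ.isSelfAdjoint_op (delta i - delta j)).toSignedMeasure)

/-- The boundary size `δ_n`: the number of vertices of `S` with a neighbour outside `S`. -/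
def boundaryCard (S : Finset G) : ℕ := {i | i ∈ S ∧ ∃ j, j ∉ S ∧ Γ.W i j ≠ 0}.ncard

/-- The underlying simple graph, used for the graph distance. -/
def graph : SimpleGraph G where
  Adj i j := i ≠ j ∧ Γ.W i j ≠ 0
  symm := ⟨fun i j h => ⟨h.1.symm, by rw [Γ.symm]; exact h.2⟩⟩
  loopless := ⟨fun _ h => h.1 rfl⟩

open Classical in
/-- The boundary correction matrix `B^{(n)}`, with parameter `P`, of the finite set of vertices `S`.
Vertices in different components are at infinite distance. -/
def B (P : ℕ) (S : Finset G) : Matrix S S ℝ := Matrix.of fun i j =>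
  if Γ.graph.edist i j ≤ P then
    ({kl : G × G | kl.1 ∈ S ∧ Γ.pairMeasure kl.1 kl.2 = Γ.pairMeasure i j}.ncard : ℝ) /
      ({kl : G × G | kl.1 ∈ S ∧ kl.2 ∈ S ∧
        Γ.pairMeasure kl.1 kl.2 = Γ.pairMeasure i j}.ncard : ℝ)
  else 1

/-- The matrix `𝒬_n(f) = B^{(n)} ⊙ 𝒦_n(f)`. -/
def Qmat (P : ℕ) (S : Finset G) (f : ℝ → ℝ) : Matrix S S ℝ := Γ.B P S ⊙ Γ.Kmat S f

/-! ### Spectral densities -/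

/-- The class `𝓕_ρ`: positive analytic functions `f` on the convex hull of the spectrum of `W` such
that `log f(x) = ∑ c_k x^k` there, with `α(log f) = ∑ |c_k| (k + 1) ≤ ρ`. -/
structure MemFρ (ρ : ℝ) (f : ℝ → ℝ) : Prop where
  analytic : AnalyticOn ℝ f Γ.hull
  pos : ∀ x ∈ Γ.hull, 0 < f x
  regular : ∃ c : ℕ → ℝ, (∀ x ∈ Γ.hull, HasSum (fun k => c k * x ^ k) (Real.log (f x))) ∧
    Summable (fun k => |c k| * ((k : ℝ) + 1)) ∧ ∑' k, |c k| * ((k : ℝ) + 1) ≤ ρ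

/-! ### Likelihoods, for observations `x` on the finite set of vertices `S` -/

open Classical in
/-- The log-likelihood `L_n`. -/
def logLik (S : Finset G) (f : ℝ → ℝ) (x : S → ℝ) : ℝ :=
  -(1 / 2) * (S.card * Real.log (2 * Real.pi) + Real.log (Γ.Kmat S f).det
    + x ⬝ᵥ ((Γ.Kmat S f)⁻¹ *ᵥ x))

open Classical in
/-- The approximated log-likelihood `L̄_n`. -/
def logLikBar (μ : Measure ℝ) (S : Finset G) (f : ℝ → ℝ) (x : S → ℝ) : ℝ :=
  -(1 / 2) * (S.card * Real.log (2 * Real.pi) + S.card * ∫ t, Real.log (f t) ∂μ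
    + x ⬝ᵥ ((Γ.Kmat S f)⁻¹ *ᵥ x))

/-- The Whittle log-likelihood `L̃_n`. -/
def logLikTilde (μ : Measure ℝ) (S : Finset G) (f : ℝ → ℝ) (x : S → ℝ) : ℝ :=
  -(1 / 2) * (S.card * Real.log (2 * Real.pi) + S.card * ∫ t, Real.log (f t) ∂μ
    + x ⬝ᵥ (Γ.Kmat S (fun t => 1 / f t) *ᵥ x))

/-- The unbiased (tapered) log-likelihood `L^{(u)}_n`. -/
def logLikUnb (μ : Measure ℝ) (P : ℕ) (S : Finset G) (f : ℝ → ℝ) (x : S → ℝ) : ℝ :=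
  -(1 / 2) * (S.card * Real.log (2 * Real.pi) + S.card * ∫ t, Real.log (f t) ∂μ
    + x ⬝ᵥ (Γ.Qmat P S (fun t => 1 / f t) *ᵥ x))

end WeightedGraph

/-- The maximizers over `Θ` of the random criteria `L n · ω` exist, and every sequence of
estimators that maximize them converges almost surely to `θ₀`. -/
def MaximizersConverge {Ω : Type*} [MeasurableSpace Ω] (Pr : Measure Ω) (Θ : Set ℝ) (θ₀ : ℝ)
    (L : ℕ → ℝ → Ω → ℝ) : Prop :=
  (∀ n ω, ∃ θ ∈ Θ, IsMaxOn (fun θ => L n θ ω) Θ θ) ∧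
  ∀ θhat : ℕ → Ω → ℝ,
    (∀ n, ∀ᵐ ω ∂Pr, θhat n ω ∈ Θ ∧ IsMaxOn (fun θ => L n θ ω) Θ (θhat n ω)) →
    ∀ᵐ ω ∂Pr, Tendsto (fun n => θhat n ω) atTop (𝓝 θ₀)

end

/-! Up to the factor -m_n/2 and a constant, each criterion is a sum (D_n(θ) + X_nᵀ A_n(θ) X_n)/m_n,
where D_n is log det K_n(f_θ) or m_n ∫ log f_θ dμ, and A_n is K_n(f_θ)⁻¹, K_n(1/f_θ) or its tapered
version. All four have the same limit, the contrast ∫ log f_θ dμ + ∫ f_{θ₀}/f_θ dμ. Its excess over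
the value at θ₀ is ∫ (t - 1 - log t) dμ with t = f_{θ₀}/f_θ, which is positive unless f_θ = f_{θ₀}
μ-almost everywhere; identifiability then makes θ₀ the only minimizer (`contrast_lt`).

Deterministic limits. Let P be the projection onto the sequences supported by G_n. Compression fails
to be multiplicative by P g(W) P h(W) P - P (gh)(W) P = -P g(W) (1 - P) h(W) P. The squared
Hilbert–Schmidt norm of (1 - P) h(W) P is O(δ_n) when h is a monomial, because W only leaves G_n
through boundary vertices, and therefore o(m_n) for every continuous h, by polynomial approximation
(`tendsto_defect_div`). By Cauchy–Schwarz such errors are invisible to the normalized trace. Hence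
traces of products, of inverses and, approximating the logarithm by polynomials, log-determinants
have the limits predicted by μ (`tendsto_trace_Kmat_inv_mul`, `tendsto_log_det_Kmat`).

Random part. A Gaussian quadratic form with bounded matrices deviates from its mean tr(A Cov) by
εm_n with probability exponentially small in m_n, so Borel–Cantelli gives a strong law for each
fixed θ (`ae_tendsto_quadratic_sub_trace`).

Uniformity in θ. The bound α(log f_θ) ≤ ρ makes log f_θ bounded and Lipschitz on the spectrum,
uniformly in θ. Pointwise continuity in θ then becomes uniform continuity for the sup norm
(`exists_delta_logClose`), and D_n/m_n and A_n are Lipschitz in log f_θ. A countable dense set of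
parameters thus suffices for almost sure uniform convergence, and compactness gives convergence of
the maximizers (`maximizersConverge_of_quadratic`).

The taper only alters entries at distance at most P. Bounded degree leaves a bounded number of these
per row, so Schur's test bounds the change in operator norm by O(u_n). -/

noncomputable section

/-! ### Real matrices: operator norm, Hilbert–Schmidt norm, determinants -/

namespace Matrix

open scoped Matrix.Norms.L2Operator

variable {n : Type*} [Fintype n]

theorem dotProduct_self_eq_norm_sq (x : n → ℝ) : x ⬝ᵥ x = ‖WithLp.toLp 2 x‖ ^ 2 := by
  rw [EuclideanSpace.norm_sq_eq]
  simp [dotProduct, sq]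

/-- The square of the Hilbert–Schmidt norm. -/
def hsSq (A : Matrix n n ℝ) : ℝ := ∑ i, ∑ j, A i j ^ 2

theorem hsSq_nonneg (A : Matrix n n ℝ) : 0 ≤ hsSq A :=
  Finset.sum_nonneg fun _ _ => Finset.sum_nonneg fun _ _ => sq_nonneg _

theorem hsSq_transpose (A : Matrix n n ℝ) : hsSq Aᵀ = hsSq A := Finset.sum_comm

theorem hsSq_add_le (A B : Matrix n n ℝ) : hsSq (A + B) ≤ 2 * hsSq A + 2 * hsSq B := by
  simp only [hsSq, Finset.mul_sum, ← Finset.sum_add_distrib]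
  refine Finset.sum_le_sum fun i _ => Finset.sum_le_sum fun j _ => ?_
  rw [add_apply]
  nlinarith [sq_nonneg (A i j - B i j)]

/-- Cauchy–Schwarz on the diagonal. This is why a squared Hilbert–Schmidt norm of order o(m) is
negligible for traces normalized by m. -/
theorem trace_sq_le (A : Matrix n n ℝ) : A.trace ^ 2 ≤ Fintype.card n * hsSq A := by
  calc A.trace ^ 2 ≤ Fintype.card n * ∑ i, A i i ^ 2 := by
        simpa [trace] using sq_sum_le_card_mul_sum_sq (s := Finset.univ) (f := fun i => A i i)
    _ ≤ _ := by
        gcongr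
        exact Finset.sum_le_sum fun i _ =>
          Finset.single_le_sum (f := fun j => A i j ^ 2) (fun _ _ => sq_nonneg _) (Finset.mem_univ i)

theorem posDef_of_le {F : Matrix n n ℝ} (hF : F.IsHermitian) {c : ℝ} (hc : 0 < c)
    (h : ∀ x, c * (x ⬝ᵥ x) ≤ x ⬝ᵥ F *ᵥ x) : F.PosDef := by
  refine PosDef.of_dotProduct_mulVec_pos hF fun x hx => ?_
  have : 0 < x ⬝ᵥ x := by
    rw [dotProduct_self_eq_norm_sq]
    have : WithLp.toLp 2 x ≠ 0 := by simpa using hx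
    positivity
  simpa using (mul_pos hc this).trans_le (h x)

variable [DecidableEq n]

theorem abs_dotProduct_mulVec_le (A : Matrix n n ℝ) (x : n → ℝ) :
    |x ⬝ᵥ A *ᵥ x| ≤ ‖A‖ * (x ⬝ᵥ x) := by
  have h := inner_toEuclideanCLM A (WithLp.toLp 2 x) (WithLp.toLp 2 x)
  simp only at h
  rw [← h, dotProduct_self_eq_norm_sq]
  calc _ ≤ ‖WithLp.toLp 2 x‖ * ‖toEuclideanCLM (𝕜 := ℝ) A (WithLp.toLp 2 x)‖ :=
        abs_real_inner_le_norm _ _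
    _ ≤ ‖WithLp.toLp 2 x‖ * (‖A‖ * ‖WithLp.toLp 2 x‖) := by
        gcongr
        exact (toEuclideanCLM (𝕜 := ℝ) A).le_opNorm _
    _ = _ := by ring

theorem mulVec_dotProduct_mulVec_le (A : Matrix n n ℝ) (x : n → ℝ) :
    (A *ᵥ x) ⬝ᵥ (A *ᵥ x) ≤ ‖A‖ ^ 2 * (x ⬝ᵥ x) := by
  rw [dotProduct_self_eq_norm_sq, dotProduct_self_eq_norm_sq, ← mul_pow]
  gcongr
  exact (toEuclideanCLM (𝕜 := ℝ) A).le_opNorm (WithLp.toLp 2 x)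

theorem l2_opNorm_le_of_forall {A : Matrix n n ℝ} {C : ℝ} (hC : 0 ≤ C)
    (h : ∀ x, (A *ᵥ x) ⬝ᵥ (A *ᵥ x) ≤ C ^ 2 * (x ⬝ᵥ x)) : ‖A‖ ≤ C := by
  rw [cstar_norm_def]
  refine ContinuousLinearMap.opNorm_le_bound _ hC fun x => ?_
  have := h x.ofLp
  rw [dotProduct_self_eq_norm_sq, dotProduct_self_eq_norm_sq, ← mul_pow] at this
  exact (sq_le_sq₀ (by positivity) (by positivity)).1 this

theorem abs_trace_le_card_mul_norm (A : Matrix n n ℝ) :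
    |A.trace| ≤ Fintype.card n * ‖A‖ := by
  have : ∀ i, |A i i| ≤ ‖A‖ := fun i => by
    have := abs_dotProduct_mulVec_le A (Pi.single i 1)
    simpa using this
  calc |A.trace| ≤ ∑ i, |A i i| := Finset.abs_sum_le_sum_abs _ _
    _ ≤ ∑ _i : n, ‖A‖ := Finset.sum_le_sum fun i _ => this i
    _ = _ := by simp

/-- The columns of `A * B` are the images under `A` of the columns of `B`. -/
theorem hsSq_mul_le (A B : Matrix n n ℝ) : hsSq (A * B) ≤ ‖A‖ ^ 2 * hsSq B := by
  rw [← hsSq_transpose, ← hsSq_transpose B]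
  simp only [hsSq, Finset.mul_sum]
  refine Finset.sum_le_sum fun j _ => ?_
  have := mulVec_dotProduct_mulVec_le A (fun i => B i j)
  simp only [dotProduct, ← sq, Finset.mul_sum] at this
  exact this

theorem l2_opNorm_transpose (A : Matrix n n ℝ) : ‖Aᵀ‖ = ‖A‖ := by
  rw [← conjTranspose_eq_transpose_of_trivial, l2_opNorm_conjTranspose]

theorem hsSq_mul_le' (A B : Matrix n n ℝ) : hsSq (A * B) ≤ ‖B‖ ^ 2 * hsSq A := by
  rw [← hsSq_transpose, transpose_mul, ← l2_opNorm_transpose B, ← hsSq_transpose A]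
  exact hsSq_mul_le _ _

theorem norm_inv_le {F : Matrix n n ℝ} (hF : F.IsHermitian) {c : ℝ} (hc : 0 < c)
    (h : ∀ x, c * (x ⬝ᵥ x) ≤ x ⬝ᵥ F *ᵥ x) : ‖F⁻¹‖ ≤ c⁻¹ := by
  have hu : IsUnit F.det := (posDef_of_le hF hc h).det_pos.ne'.isUnit
  refine l2_opNorm_le_of_forall (by positivity) fun x => ?_
  set y := F⁻¹ *ᵥ x with hy
  have hx : F *ᵥ y = x := by rw [hy, mulVec_mulVec, mul_nonsing_inv _ hu, one_mulVec]
  have h1 := h y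
  rw [hx] at h1
  rw [dotProduct_self_eq_norm_sq] at h1 ⊢
  rw [dotProduct_self_eq_norm_sq, ← mul_pow]
  gcongr
  have h2 : y ⬝ᵥ x ≤ ‖WithLp.toLp 2 y‖ * ‖WithLp.toLp 2 x‖ := by
    have := real_inner_le_norm (WithLp.toLp 2 y) (WithLp.toLp 2 x)
    simpa [PiLp.inner_apply, dotProduct, mul_comm] using this
  rcases (norm_nonneg (WithLp.toLp 2 y)).eq_or_lt with h0 | h0
  · rw [← h0]; positivity
  · rw [inv_mul_eq_div, le_div_iff₀ hc]
    have : ‖WithLp.toLp 2 y‖ * (‖WithLp.toLp 2 y‖ * c) ≤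
        ‖WithLp.toLp 2 y‖ * ‖WithLp.toLp 2 x‖ := by nlinarith
    exact le_of_mul_le_mul_left this h0

/-- Resolvent identity F⁻¹ - F'⁻¹ = -F⁻¹ (F - F') F'⁻¹. -/
theorem norm_inv_sub_inv_le {F F' : Matrix n n ℝ} (hF : F.IsHermitian) (hF' : F'.IsHermitian)
    {c : ℝ} (hc : 0 < c) (h : ∀ x, c * (x ⬝ᵥ x) ≤ x ⬝ᵥ F *ᵥ x)
    (h' : ∀ x, c * (x ⬝ᵥ x) ≤ x ⬝ᵥ F' *ᵥ x) :
    ‖F⁻¹ - F'⁻¹‖ ≤ c⁻¹ * ‖F - F'‖ * c⁻¹ := by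
  have hu : IsUnit F.det := (posDef_of_le hF hc h).det_pos.ne'.isUnit
  have hu' : IsUnit F'.det := (posDef_of_le hF' hc h').det_pos.ne'.isUnit
  have : F⁻¹ - F'⁻¹ = -(F⁻¹ * (F - F') * F'⁻¹) := by
    rw [mul_sub, sub_mul, nonsing_inv_mul _ hu, mul_assoc, mul_nonsing_inv _ hu']
    simp
  rw [this, norm_neg]
  refine (norm_mul_le _ _).trans ?_
  gcongr
  · refine (norm_mul_le _ _).trans ?_
    gcongr
    exact norm_inv_le hF hc h
  · exact norm_inv_le hF' hc h'

/-- Simultaneous diagonalization of a positive definite and a symmetric matrix. -/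
theorem PosDef.exists_simultaneous_diagonal {F F' : Matrix n n ℝ} (hF' : F'.PosDef)
    (hF : F.IsHermitian) :
    ∃ (R : Matrix n n ℝ) (d : n → ℝ), IsUnit R.det ∧ Rᵀ * F' * R = 1 ∧ Rᵀ * F * R = diagonal d := by
  open scoped MatrixOrder in
  have hu : IsUnit F'.det := hF'.det_pos.ne'.isUnit
  set S : Matrix n n ℝ := CFC.sqrt F' with hS
  have hSS : S * S = F' := CFC.sqrt_mul_sqrt_self F' hF'.posSemidef.nonneg
  have hSh : Sᵀ = S := by
    have := (nonneg_iff_posSemidef.1 (CFC.sqrt_nonneg F')).1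
    rwa [IsHermitian, conjTranspose_eq_transpose_of_trivial] at this
  have hSu : IsUnit S.det := by
    rw [← hSS, det_mul] at hu
    exact isUnit_of_mul_isUnit_left hu
  have hM : (S⁻¹ * F * S⁻¹).IsHermitian := by
    have hFt : Fᵀ = F := by rwa [IsHermitian, conjTranspose_eq_transpose_of_trivial] at hF
    rw [IsHermitian, conjTranspose_eq_transpose_of_trivial]
    simp [transpose_mul, transpose_nonsing_inv, hSh, hFt, mul_assoc]
  set U : Matrix n n ℝ := (hM.eigenvectorUnitary : Matrix n n ℝ) with hU
  have hUU : Uᵀ * U = 1 := by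
    have := Unitary.coe_star_mul_self hM.eigenvectorUnitary
    rwa [star_eq_conjTranspose, conjTranspose_eq_transpose_of_trivial] at this
  have hspec : Uᵀ * (S⁻¹ * F * S⁻¹) * U = diagonal hM.eigenvalues := by
    have := hM.conjStarAlgAut_star_eigenvectorUnitary
    rw [Unitary.conjStarAlgAut_apply] at this
    simpa [star_eq_conjTranspose, conjTranspose_eq_transpose_of_trivial] using this
  -- With S = F'^(1/2), the congruence by S⁻¹ turns F' into the identity and keeps F symmetric; the
  -- orthogonal U then diagonalizes the image of F without disturbing the identity.
  refine ⟨S⁻¹ * U, hM.eigenvalues, ?_, ?_, ?_⟩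
  · rw [det_mul]
    refine (isUnit_nonsing_inv_det _ hSu).mul ?_
    have := congrArg det hUU
    rw [det_mul, det_transpose, det_one] at this
    exact IsUnit.of_mul_eq_one _ this
  · rw [transpose_mul, transpose_nonsing_inv, hSh, ← hSS]
    calc Uᵀ * S⁻¹ * (S * S) * (S⁻¹ * U) = Uᵀ * ((S⁻¹ * S) * (S * S⁻¹)) * U := by
          simp only [mul_assoc]
      _ = 1 := by rw [nonsing_inv_mul _ hSu, mul_nonsing_inv _ hSu]; simpa using hUU
  · rw [transpose_mul, transpose_nonsing_inv, hSh, ← hspec]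
    simp only [mul_assoc]

/-- In a basis orthonormal for F' and orthogonal for F, the difference is Σ log d_i ≤ Σ (d_i - 1).
Each basis vector x has xᵀF'x = 1, hence xᵀx ≤ c⁻¹, so d_i - 1 = xᵀ(F - F')x is at most c⁻¹‖F - F'‖.
-/
theorem log_det_sub_log_det_le {F F' : Matrix n n ℝ} (hF : F.IsHermitian) (hF' : F'.IsHermitian)
    {c : ℝ} (hc : 0 < c) (h : ∀ x, c * (x ⬝ᵥ x) ≤ x ⬝ᵥ F *ᵥ x)
    (h' : ∀ x, c * (x ⬝ᵥ x) ≤ x ⬝ᵥ F' *ᵥ x) :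
    Real.log F.det - Real.log F'.det ≤ Fintype.card n * (c⁻¹ * ‖F - F'‖) := by
  have hFp := posDef_of_le hF hc h
  have hFp' := posDef_of_le hF' hc h'
  obtain ⟨R, d, hR, h1, h2⟩ := hFp'.exists_simultaneous_diagonal hF
  have hd : ∀ i, 0 < d i ∧ d i ≤ 1 + c⁻¹ * ‖F - F'‖ := fun i => by
    set x : n → ℝ := R *ᵥ Pi.single i 1 with hx
    have key : ∀ M : Matrix n n ℝ, x ⬝ᵥ M *ᵥ x = (Rᵀ * M * R) i i := fun M => by
      rw [hx, dotProduct_mulVec, vecMul_mulVec, ← dotProduct_mulVec, mulVec_mulVec]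
      simp
    have e1 : x ⬝ᵥ F' *ᵥ x = 1 := by rw [key, h1]; simp
    have e2 : x ⬝ᵥ F *ᵥ x = d i := by rw [key, h2]; simp
    have hx0 : x ≠ 0 := by
      intro h0
      rw [h0] at e1
      simp at e1
    have hxx : 0 < x ⬝ᵥ x := by
      rw [dotProduct_self_eq_norm_sq]
      have : WithLp.toLp 2 x ≠ 0 := by simpa using hx0
      positivity
    have hb := (le_abs_self _).trans (abs_dotProduct_mulVec_le (F - F') x)
    rw [sub_mulVec, dotProduct_sub, e1, e2] at hb
    have h3 := h x
    have h4 := h' x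
    rw [e1] at h4
    rw [e2] at h3
    refine ⟨by nlinarith, ?_⟩
    have : x ⬝ᵥ x ≤ c⁻¹ := by rwa [← one_div, le_div_iff₀ hc, mul_comm]
    nlinarith [norm_nonneg (F - F'), mul_le_mul_of_nonneg_left this (norm_nonneg (F - F'))]
  -- The first congruence gives (det R)² det F' = 1, so the product of the d_i is det F / det F'.
  have e : Real.log F.det - Real.log F'.det = ∑ i, Real.log (d i) := by
    rw [← Real.log_prod fun i _ => (hd i).1.ne', ← Real.log_div hFp.det_pos.ne' hFp'.det_pos.ne',
      ← det_diagonal, ← h2]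
    have h1' := congrArg det h1
    simp only [det_mul, det_transpose, det_one] at h1' ⊢
    congr 1
    rw [div_eq_iff hFp'.det_pos.ne']
    linear_combination -F.det * h1'
  rw [e]
  calc ∑ i, Real.log (d i) ≤ ∑ _i : n, c⁻¹ * ‖F - F'‖ := Finset.sum_le_sum fun i _ => by
        have := Real.log_le_sub_one_of_pos (hd i).1
        linarith [(hd i).2]
    _ = _ := by simp

theorem abs_log_det_sub_log_det_le {F F' : Matrix n n ℝ} (hF : F.IsHermitian)
    (hF' : F'.IsHermitian) {c : ℝ} (hc : 0 < c) (h : ∀ x, c * (x ⬝ᵥ x) ≤ x ⬝ᵥ F *ᵥ x)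
    (h' : ∀ x, c * (x ⬝ᵥ x) ≤ x ⬝ᵥ F' *ᵥ x) :
    |Real.log F.det - Real.log F'.det| ≤ Fintype.card n * (c⁻¹ * ‖F - F'‖) := by
  refine abs_sub_le_iff.2 ⟨log_det_sub_log_det_le hF hF' hc h h', ?_⟩
  rw [norm_sub_rev]
  exact log_det_sub_log_det_le hF' hF hc h' h

theorem IsHermitian.trace_aeval {F : Matrix n n ℝ} (hF : F.IsHermitian) (p : Polynomial ℝ) :
    (Polynomial.aeval F p).trace = ∑ i, p.eval (hF.eigenvalues i) := by
  conv_lhs => rw [hF.spectral_theorem]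
  have h0 := Polynomial.aeval_algHom_apply
    (Unitary.conjStarAlgAut ℝ (Matrix n n ℝ) hF.eigenvectorUnitary)
    (diagonal (RCLike.ofReal ∘ hF.eigenvalues)) p
  rw [h0]
  have h1 : Polynomial.aeval (diagonal (RCLike.ofReal ∘ hF.eigenvalues) : Matrix n n ℝ) p =
      diagonal fun i => p.eval (hF.eigenvalues i) := by
    have := Polynomial.aeval_algHom_apply (diagonalAlgHom ℝ (n := n) (α := ℝ))
      (RCLike.ofReal ∘ hF.eigenvalues) p
    simp only [diagonalAlgHom_apply] at this
    rw [this]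
    congr 1
    ext i
    simp
  rw [h1, Unitary.conjStarAlgAut_apply, trace_mul_cycle, Unitary.coe_star_mul_self, one_mul,
    trace_diagonal]

theorem IsHermitian.le_eigenvalues {F : Matrix n n ℝ} (hF : F.IsHermitian) {c : ℝ}
    (h : ∀ x, c * (x ⬝ᵥ x) ≤ x ⬝ᵥ F *ᵥ x) (i : n) : c ≤ hF.eigenvalues i := by
  have h1 := h (hF.eigenvectorBasis i)
  rw [hF.mulVec_eigenvectorBasis, dotProduct_smul, dotProduct_self_eq_norm_sq] at h1
  simpa using h1

theorem IsHermitian.eigenvalues_le_norm {F : Matrix n n ℝ} (hF : F.IsHermitian) (i : n) :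
    hF.eigenvalues i ≤ ‖F‖ := by
  have h1 := (le_abs_self _).trans (abs_dotProduct_mulVec_le F (hF.eigenvectorBasis i))
  rw [hF.mulVec_eigenvectorBasis, dotProduct_smul, dotProduct_self_eq_norm_sq] at h1
  simpa using h1

/-- If a polynomial approximates the logarithm on an interval containing the spectrum, then its
trace approximates the logarithm of the determinant. -/
theorem abs_log_det_sub_trace_aeval_le {F : Matrix n n ℝ} (hF : F.IsHermitian) {c C : ℝ}
    (hc : 0 < c) (h : ∀ x, c * (x ⬝ᵥ x) ≤ x ⬝ᵥ F *ᵥ x) (hC : ‖F‖ ≤ C) {p : Polynomial ℝ} {ε : ℝ}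
    (hp : ∀ t ∈ Set.Icc c C, |Real.log t - p.eval t| ≤ ε) :
    |Real.log F.det - (Polynomial.aeval F p).trace| ≤ Fintype.card n * ε := by
  have hmem : ∀ i, hF.eigenvalues i ∈ Set.Icc c C := fun i =>
    ⟨hF.le_eigenvalues h i, (hF.eigenvalues_le_norm i).trans hC⟩
  rw [hF.trace_aeval, hF.det_eq_prod_eigenvalues, Real.log_prod
    fun i _ => by simpa using (hc.trans_le (hmem i).1).ne', ← Finset.sum_sub_distrib]
  calc _ ≤ ∑ i, |Real.log (hF.eigenvalues i) - p.eval (hF.eigenvalues i)| :=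
        Finset.abs_sum_le_sum_abs _ _
    _ ≤ ∑ _i : n, ε := Finset.sum_le_sum fun i _ => hp _ (hmem i)
    _ = _ := by simp

end Matrix

end

noncomputable section

/-! ### Continuous functional calculus of a self-adjoint operator -/

section OperatorFunction

variable {H : Type*} [NormedAddCommGroup H] [InnerProductSpace ℂ H] [CompleteSpace H]
  {A : H →L[ℂ] H}

theorem norm_operatorFunction_le_of_forall {g : ℝ → ℝ} {C : ℝ} (hC : 0 ≤ C)
    (h : ∀ x ∈ spectrum ℝ A, |g x| ≤ C) : ‖operatorFunction A g‖ ≤ C :=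
  norm_cfc_le hC h

theorem operatorFunction_monomial (hA : IsSelfAdjoint A) (c : ℝ) (k : ℕ) :
    operatorFunction A (fun x => c * x ^ k) = (c : ℂ) • A ^ k := by
  rw [operatorFunction, cfc_const_mul c (fun x => x ^ k) A, cfc_pow_id A k, Complex.coe_smul]

theorem operatorFunction_add {g h : ℝ → ℝ} (hg : ContinuousOn g (spectrum ℝ A))
    (hh : ContinuousOn h (spectrum ℝ A)) :
    operatorFunction A (fun x => g x + h x) = operatorFunction A g + operatorFunction A h :=
  cfc_add A g h hg hh

theorem isSelfAdjoint_operatorFunction (A : H →L[ℂ] H) (g : ℝ → ℝ) :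
    IsSelfAdjoint (operatorFunction A g) :=
  cfc_predicate g A

theorem operatorFunction_sub {g h : ℝ → ℝ} (hg : ContinuousOn g (spectrum ℝ A))
    (hh : ContinuousOn h (spectrum ℝ A)) :
    operatorFunction A (fun x => g x - h x) = operatorFunction A g - operatorFunction A h :=
  cfc_sub g h A hg hh

theorem operatorFunction_mul {g h : ℝ → ℝ} (hg : ContinuousOn g (spectrum ℝ A))
    (hh : ContinuousOn h (spectrum ℝ A)) :
    operatorFunction A (fun x => g x * h x) = operatorFunction A g * operatorFunction A h :=
  cfc_mul g h A hg hh

theorem operatorFunction_const (hA : IsSelfAdjoint A) (c : ℝ) :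
    operatorFunction A (fun _ => c) = (c : ℂ) • 1 := by
  simpa using operatorFunction_monomial hA c 0

theorem operatorFunction_congr {g h : ℝ → ℝ} (hgh : Set.EqOn g h (spectrum ℝ A)) :
    operatorFunction A g = operatorFunction A h := cfc_congr hgh

theorem operatorFunction_nonneg {g : ℝ → ℝ} (h : ∀ x ∈ spectrum ℝ A, 0 ≤ g x) :
    0 ≤ operatorFunction A g := cfc_nonneg h

end OperatorFunction

/-! ### Functions of the adjacency operator -/

namespace WeightedGraph

open scoped Matrix.Norms.L2Operator
open Classical

variable {G : Type*} (Γ : WeightedGraph G)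

theorem norm_op_le_one : ‖Γ.op‖ ≤ 1 := LinearMap.mkContinuous_norm_le _ zero_le_one _

theorem isCompact_Sp : IsCompact Γ.Sp := spectrum.isCompact (𝕜 := ℝ) Γ.op

theorem Sp_subset_Icc : Γ.Sp ⊆ Set.Icc (-1) 1 := fun x hx => by
  have h1 : ‖x‖ ≤ ‖Γ.op‖ * ‖(1 : lp (fun _ : G => ℂ) 2 →L[ℂ] lp (fun _ : G => ℂ) 2)‖ :=
    spectrum.norm_le_norm_mul_of_mem hx
  have h2 : ‖(1 : lp (fun _ : G => ℂ) 2 →L[ℂ] lp (fun _ : G => ℂ) 2)‖ ≤ 1 :=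
    ContinuousLinearMap.norm_id_le
  have h3 : |x| ≤ 1 := h1.trans (mul_le_one₀ Γ.norm_op_le_one (norm_nonneg _) h2)
  exact _root_.abs_le.1 h3

/-- Tietze extension. Weak convergence is tested on bounded continuous functions of the whole line,
whereas the densities are only controlled on the spectrum. -/
theorem exists_boundedContinuous_eqOn {g : ℝ → ℝ} (hg : ContinuousOn g Γ.Sp) :
    ∃ g' : BoundedContinuousFunction ℝ ℝ, Set.EqOn g g' Γ.Sp := by
  have : CompactSpace Γ.Sp := isCompact_iff_compactSpace.1 Γ.isCompact_Sp
  obtain ⟨g', -, hg'⟩ :=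
    BoundedContinuousFunction.exists_extension_norm_eq_of_isClosedEmbedding
      (BoundedContinuousFunction.mkOfCompact ⟨Γ.Sp.domRestrict g, hg.domRestrict⟩)
      Γ.isCompact_Sp.isClosed.isClosedEmbedding_subtypeVal
  exact ⟨g', fun x hx => (congrFun hg' ⟨x, hx⟩).symm⟩

theorem exists_polynomial_near {g : ℝ → ℝ} (hg : ContinuousOn g Γ.Sp) {ε : ℝ} (hε : 0 < ε) :
    ∃ p : Polynomial ℝ, ∀ x ∈ Γ.Sp, |g x - p.eval x| ≤ ε := by
  obtain ⟨g', hg'⟩ := Γ.exists_boundedContinuous_eqOn hg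
  obtain ⟨p, hp⟩ := exists_polynomial_near_of_continuousOn (-1) 1 g' g'.continuous.continuousOn ε hε
  refine ⟨p, fun x hx => ?_⟩
  rw [hg' hx, abs_sub_comm]
  exact (hp x (Γ.Sp_subset_Icc hx)).le

/-- An operator which preserves the real-valued sequences. -/
def PreservesReal (A : lp (fun _ : G => ℂ) 2 →L[ℂ] lp (fun _ : G => ℂ) 2) : Prop :=
  ∀ u : lp (fun _ : G => ℂ) 2, (∀ i, (u i).im = 0) → ∀ i, (A u i).im = 0

theorem preservesReal_op : PreservesReal Γ.op := fun u hu i => by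
  rw [op_apply, Complex.im_tsum (Γ.summable_mul u i)]
  simp [hu]

theorem preservesReal_operatorFunction_eval (p : Polynomial ℝ) :
    PreservesReal (operatorFunction Γ.op fun x => p.eval x) := by
  induction p using Polynomial.induction_on' with
  | add p q hp hq =>
    intro u hu i
    simp only [Polynomial.eval_add]
    rw [operatorFunction_add p.continuous.continuousOn q.continuous.continuousOn]
    simp [hp u hu i, hq u hu i]
  | monomial k c =>
    have hk : PreservesReal (Γ.op ^ k) := by
      induction k with
      | zero => exact fun u hu i => hu i
      | succ k ih =>
        intro u hu
        rw [pow_succ]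
        exact ih _ (Γ.preservesReal_op u hu)
    intro u hu i
    simp only [Polynomial.eval_monomial]
    rw [operatorFunction_monomial Γ.isSelfAdjoint_op]
    have := hk u hu i
    simp only [smul_apply, lp.coeFn_smul, Pi.smul_apply, smul_eq_mul]
    rw [Complex.im_ofReal_mul, this, mul_zero]

theorem norm_apply_le (A : lp (fun _ : G => ℂ) 2 →L[ℂ] lp (fun _ : G => ℂ) 2)
    (u : lp (fun _ : G => ℂ) 2) (i : G) : ‖A u i‖ ≤ ‖A‖ * ‖u‖ :=
  (lp.norm_apply_le_norm (by norm_num) _ i).trans (A.le_opNorm u)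

/-- `K` is defined as a real part, on a complex space. Reality passes from W to its polynomials and
then to limits, so nothing is lost: the real matrices `Kmat` act exactly as the compressed
operators. -/
theorem preservesReal_operatorFunction {g : ℝ → ℝ} (hg : ContinuousOn g Γ.Sp) :
    PreservesReal (operatorFunction Γ.op g) := by
  intro u hu i
  rw [← abs_eq_zero]
  refine le_antisymm (le_of_forall_pos_le_add fun ε hε => ?_) (abs_nonneg _)
  obtain ⟨p, hp⟩ := Γ.exists_polynomial_near hg (ε := ε / (‖u‖ + 1)) (by positivity)
  have h1 : ‖operatorFunction Γ.op g - operatorFunction Γ.op fun x => p.eval x‖ ≤ ε / (‖u‖ + 1) := by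
    rw [← operatorFunction_sub hg p.continuous.continuousOn]
    exact norm_operatorFunction_le_of_forall (by positivity) hp
  have h2 := norm_apply_le (operatorFunction Γ.op g - operatorFunction Γ.op (fun x => p.eval x)) u i
  have h3 : (operatorFunction Γ.op g u i).im =
      ((operatorFunction Γ.op g - operatorFunction Γ.op (fun x => p.eval x)) u i).im := by
    simp [Γ.preservesReal_operatorFunction_eval p u hu i]
  rw [h3, zero_add]
  refine (Complex.abs_im_le_norm _).trans (h2.trans ?_)
  calc _ ≤ ε / (‖u‖ + 1) * (‖u‖ + 1) := by gcongr; linarith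
    _ = ε := by field_simp

theorem delta_apply (i j : G) : delta i j = if j = i then (1 : ℂ) else 0 := by
  rw [delta, Subsingleton.elim (Classical.decEq G) (fun a b => Classical.propDecidable (a = b))]
  rw [lp.single_apply]
  by_cases h : j = i
  · subst h; simp
  · simp [h]

theorem norm_delta (i : G) : ‖delta i‖ = 1 := by
  rw [delta, Subsingleton.elim (Classical.decEq G) (fun a b => Classical.propDecidable (a = b))]
  rw [lp.norm_single (by norm_num)]
  simp

theorem operatorFunction_delta_apply {g : ℝ → ℝ} (hg : ContinuousOn g Γ.Sp) (i j : G) :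
    operatorFunction Γ.op g (delta j) i = (Γ.K g i j : ℂ) := by
  have : (operatorFunction Γ.op g (delta j) i).im = 0 := by
    refine Γ.preservesReal_operatorFunction hg _ (fun k => ?_) i
    rw [delta_apply]
    split_ifs <;> simp
  rw [K, inner_delta]
  exact Complex.ext (by simp) (by simp [this])

theorem K_symm (g : ℝ → ℝ) (i j : G) : Γ.K g i j = Γ.K g j i := by
  have h := (isSelfAdjoint_operatorFunction Γ.op g).isSymmetric (delta i) (delta j)
  simp only [ContinuousLinearMap.coe_coe] at h
  rw [K, K, ← h, ← inner_conj_symm, Complex.conj_re]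

theorem Kmat_apply (S : Finset G) (g : ℝ → ℝ) (i j : S) : Γ.Kmat S g i j = Γ.K g i j := rfl

theorem isHermitian_Kmat (S : Finset G) (g : ℝ → ℝ) : (Γ.Kmat S g).IsHermitian := by
  rw [Matrix.IsHermitian, Matrix.conjTranspose_eq_transpose_of_trivial]
  ext i j
  exact Γ.K_symm g j i

theorem Kmat_sub (S : Finset G) {g h : ℝ → ℝ} (hg : ContinuousOn g Γ.Sp)
    (hh : ContinuousOn h Γ.Sp) : Γ.Kmat S (fun x => g x - h x) = Γ.Kmat S g - Γ.Kmat S h := by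
  ext i j
  simp [Kmat_apply, K, operatorFunction_sub hg hh]

theorem Kmat_congr (S : Finset G) {g h : ℝ → ℝ} (hgh : Set.EqOn g h Γ.Sp) :
    Γ.Kmat S g = Γ.Kmat S h := by
  ext i j
  simp [Kmat_apply, K, operatorFunction_congr hgh]

theorem Kmat_const (S : Finset G) (c : ℝ) : Γ.Kmat S (fun _ => c) = c • 1 := by
  ext i j
  rw [Kmat_apply, K, operatorFunction_const Γ.isSelfAdjoint_op, inner_delta]
  simp only [smul_apply, one_apply_eq_self, lp.coeFn_smul,
    Pi.smul_apply, delta_apply, Matrix.smul_apply, Matrix.one_apply]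
  by_cases h : i = j
  · simp [h]
  · have : (i : G) ≠ j := fun h' => h (Subtype.ext h')
    simp [h, this]

/-- The finitely supported sequence with values `x` on `S`. -/
def extend (S : Finset G) (x : S → ℝ) : lp (fun _ : G => ℂ) 2 := ∑ i : S, (x i : ℂ) • delta (i : G)

theorem inner_extend (S : Finset G) (x : S → ℝ) (u : lp (fun _ : G => ℂ) 2) :
    inner ℂ (extend S x) u = ∑ i : S, (x i : ℂ) * u i := by
  simp [extend, inner_delta]

theorem extend_apply (S : Finset G) (x : S → ℝ) (i : S) : extend S x i = x i := by
  rw [extend, lp.coeFn_sum, Finset.sum_apply, Finset.sum_eq_single i]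
  · rw [lp.coeFn_smul]; simp [delta_apply]
  · intro j _ hj
    have : (i : G) ≠ j := fun h => hj (Subtype.ext h.symm)
    rw [lp.coeFn_smul]; simp [delta_apply, this]
  · simp

theorem norm_extend_sq (S : Finset G) (x : S → ℝ) : ‖extend S x‖ ^ 2 = x ⬝ᵥ x := by
  have h : inner ℂ (extend S x) (extend S x) = ((x ⬝ᵥ x : ℝ) : ℂ) := by
    rw [inner_extend]
    simp [extend_apply, dotProduct]
  rw [← inner_self_eq_norm_sq (𝕜 := ℂ), h]
  simp

theorem Kmat_mulVec (S : Finset G) {g : ℝ → ℝ} (hg : ContinuousOn g Γ.Sp) (x : S → ℝ) (i : S) :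
    operatorFunction Γ.op g (extend S x) i = ((Γ.Kmat S g *ᵥ x) i : ℂ) := by
  rw [extend, map_sum, lp.coeFn_sum, Finset.sum_apply]
  simp only [map_smul, lp.coeFn_smul, Pi.smul_apply, Γ.operatorFunction_delta_apply hg]
  simp [Matrix.mulVec, dotProduct, Kmat_apply, mul_comm]

theorem sum_norm_sq_apply_le (S : Finset G) (u : lp (fun _ : G => ℂ) 2) :
    ∑ i : S, ‖u i‖ ^ 2 ≤ ‖u‖ ^ 2 := by
  have := lp.sum_rpow_le_norm_rpow (p := 2) (by norm_num) u S
  simp only [ENNReal.toReal_ofNat, Real.rpow_ofNat] at this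
  rwa [Finset.sum_coe_sort S fun i => ‖u i‖ ^ 2]

/-- A compression does not increase the operator norm. -/
theorem norm_Kmat_le (S : Finset G) {g : ℝ → ℝ} (hg : ContinuousOn g Γ.Sp) {C : ℝ} (hC : 0 ≤ C)
    (h : ∀ x ∈ Γ.Sp, |g x| ≤ C) : ‖Γ.Kmat S g‖ ≤ C := by
  refine Matrix.l2_opNorm_le_of_forall hC fun x => ?_
  calc (Γ.Kmat S g *ᵥ x) ⬝ᵥ (Γ.Kmat S g *ᵥ x)
      = ∑ i : S, ‖operatorFunction Γ.op g (extend S x) i‖ ^ 2 := by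
        simp [Γ.Kmat_mulVec S hg, dotProduct, sq]
    _ ≤ ‖operatorFunction Γ.op g (extend S x)‖ ^ 2 := sum_norm_sq_apply_le _ _
    _ ≤ (C * ‖extend S x‖) ^ 2 := by
        gcongr
        exact (ContinuousLinearMap.le_opNorm _ _).trans
          (by gcongr; exact norm_operatorFunction_le_of_forall hC h)
    _ = _ := by rw [mul_pow, norm_extend_sq]

theorem norm_Kmat_sub_le (S : Finset G) {g h : ℝ → ℝ} (hg : ContinuousOn g Γ.Sp)
    (hh : ContinuousOn h Γ.Sp) {C : ℝ} (hC : 0 ≤ C) (H : ∀ x ∈ Γ.Sp, |g x - h x| ≤ C) :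
    ‖Γ.Kmat S g - Γ.Kmat S h‖ ≤ C := by
  rw [← Γ.Kmat_sub S hg hh]
  exact Γ.norm_Kmat_le S (hg.sub hh) hC H

/-- The operator g(W) - c is positive, and so is its compression. -/
theorem le_dotProduct_Kmat (S : Finset G) {g : ℝ → ℝ} (hg : ContinuousOn g Γ.Sp) {c : ℝ}
    (h : ∀ x ∈ Γ.Sp, c ≤ g x) (x : S → ℝ) : c * (x ⬝ᵥ x) ≤ x ⬝ᵥ Γ.Kmat S g *ᵥ x := by
  have h0 : 0 ≤ operatorFunction Γ.op (fun t => g t - c) :=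
    operatorFunction_nonneg fun t ht => sub_nonneg.2 (h t ht)
  have h1 := ((ContinuousLinearMap.nonneg_iff_isPositive _).1 h0).inner_nonneg_right (extend S x)
  have hgc : ContinuousOn (fun t => g t - c) Γ.Sp := hg.sub continuousOn_const
  rw [inner_extend] at h1
  simp only [Γ.Kmat_mulVec S hgc] at h1
  have h2 : 0 ≤ x ⬝ᵥ (Γ.Kmat S (fun t => g t - c) *ᵥ x) := by
    rw [dotProduct]
    exact_mod_cast h1
  rw [Γ.Kmat_sub S hg continuousOn_const, Kmat_const, Matrix.sub_mulVec, dotProduct_sub,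
    Matrix.smul_mulVec, Matrix.one_mulVec, dotProduct_smul] at h2
  simpa using h2

end WeightedGraph

end

noncomputable section

/-! ### Compressions to finite sets of vertices -/

namespace WeightedGraph

open scoped Matrix.Norms.L2Operator
open Classical

/-! ### Hilbert–Schmidt norms and projections onto finitely many vertices. -/

section HilbertSchmidt

variable {G : Type*}

/-- The square of the Hilbert–Schmidt norm of an operator on `ℓ²(G)`. -/
def hsNormSq (A : lp (fun _ : G => ℂ) 2 →L[ℂ] lp (fun _ : G => ℂ) 2) : ℝ≥0∞ :=
  ∑' i, ‖A (delta i)‖ₑ ^ 2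

theorem enorm_sq_eq_ofReal {E : Type*} [SeminormedAddCommGroup E] (x : E) :
    ‖x‖ₑ ^ 2 = ENNReal.ofReal (‖x‖ ^ 2) := by
  rw [ENNReal.ofReal_pow (norm_nonneg _), ofReal_norm]

theorem enorm_sq_eq_tsum (u : lp (fun _ : G => ℂ) 2) : ‖u‖ₑ ^ 2 = ∑' i, ‖u i‖ₑ ^ 2 := by
  have hu : HasSum (fun j => ‖u j‖ ^ 2) (‖u‖ ^ 2) := by
    simpa using lp.hasSum_norm (p := 2) (by norm_num) u
  simp only [enorm_sq_eq_ofReal]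
  rw [← hu.tsum_eq, ENNReal.ofReal_tsum_of_nonneg (fun _ => by positivity) hu.summable]

theorem norm_add_sq_le {E : Type*} [SeminormedAddCommGroup E] (x y : E) :
    ‖x + y‖ ^ 2 ≤ 2 * ‖x‖ ^ 2 + 2 * ‖y‖ ^ 2 := by
  have h := norm_add_le x y
  nlinarith [sq_nonneg (‖x‖ - ‖y‖), norm_nonneg (x + y)]

theorem enorm_add_sq_le {E : Type*} [SeminormedAddCommGroup E] (x y : E) :
    ‖x + y‖ₑ ^ 2 ≤ 2 * ‖x‖ₑ ^ 2 + 2 * ‖y‖ₑ ^ 2 := by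
  have h2 : (2 : ℝ≥0∞) = ENNReal.ofReal 2 := by simp
  simp only [enorm_sq_eq_ofReal]
  rw [h2, ← ENNReal.ofReal_mul zero_le_two, ← ENNReal.ofReal_mul zero_le_two,
    ← ENNReal.ofReal_add (by positivity) (by positivity)]
  exact ENNReal.ofReal_le_ofReal (norm_add_sq_le _ _)

/-- By Parseval both sides are the sum of the squared moduli of all matrix entries. Values in `ℝ≥0∞`
allow the sums to be exchanged without summability conditions. -/
theorem hsNormSq_adjoint (A : lp (fun _ : G => ℂ) 2 →L[ℂ] lp (fun _ : G => ℂ) 2) :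
    hsNormSq (star A) = hsNormSq A := by
  simp only [hsNormSq, enorm_sq_eq_tsum]
  rw [ENNReal.tsum_comm]
  refine tsum_congr fun i => tsum_congr fun j => ?_
  rw [← inner_delta, ← inner_delta, ContinuousLinearMap.star_eq_adjoint,
    ContinuousLinearMap.adjoint_inner_right, ← inner_conj_symm]
  congr 1
  rw [← ofReal_norm, ← ofReal_norm, RCLike.norm_conj]

theorem hsNormSq_mul_le_of_norm_le_one
    {A B : lp (fun _ : G => ℂ) 2 →L[ℂ] lp (fun _ : G => ℂ) 2} (hA : ‖A‖ ≤ 1) :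
    hsNormSq (A * B) ≤ hsNormSq B := by
  refine ENNReal.tsum_le_tsum fun i => ?_
  gcongr
  refine enorm_le_iff_norm_le.2 ?_
  have := (A.le_opNorm (B (delta i))).trans
    (mul_le_of_le_one_left (norm_nonneg _) hA)
  exact this

theorem hsNormSq_mul_le_of_norm_le_one'
    {A B : lp (fun _ : G => ℂ) 2 →L[ℂ] lp (fun _ : G => ℂ) 2} (hB : ‖B‖ ≤ 1) :
    hsNormSq (A * B) ≤ hsNormSq A := by
  rw [← hsNormSq_adjoint, star_mul, ← hsNormSq_adjoint A]
  exact hsNormSq_mul_le_of_norm_le_one (by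
    rwa [ContinuousLinearMap.star_eq_adjoint, LinearIsometryEquiv.norm_map])

theorem hsNormSq_add_le (A B : lp (fun _ : G => ℂ) 2 →L[ℂ] lp (fun _ : G => ℂ) 2) :
    hsNormSq (A + B) ≤ 2 * hsNormSq A + 2 * hsNormSq B := by
  rw [hsNormSq, hsNormSq, hsNormSq, ← ENNReal.tsum_mul_left, ← ENNReal.tsum_mul_left,
    ← ENNReal.tsum_add]
  refine ENNReal.tsum_le_tsum fun i => ?_
  exact enorm_add_sq_le _ _

/-- The orthogonal projection onto the sequences supported by `S`. -/
def proj (S : Finset G) : lp (fun _ : G => ℂ) 2 →L[ℂ] lp (fun _ : G => ℂ) 2 :=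
  (Submodule.span ℂ ((S.image delta : Finset (lp (fun _ : G => ℂ) 2)) : Set _)).starProjection

theorem isSelfAdjoint_proj (S : Finset G) : IsSelfAdjoint (proj S) :=
  isSelfAdjoint_starProjection _

theorem norm_proj_le_one (S : Finset G) : ‖proj S‖ ≤ 1 := Submodule.starProjection_norm_le _

theorem proj_delta_of_mem {S : Finset G} {i : G} (hi : i ∈ S) : proj S (delta i) = delta i :=
  Submodule.starProjection_eq_self_iff.2 <| Submodule.subset_span <| by
    simpa using ⟨i, hi, rfl⟩

theorem proj_delta_of_notMem {S : Finset G} {i : G} (hi : i ∉ S) : proj S (delta i) = 0 := by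
  refine (Submodule.starProjection_apply_eq_zero_iff _).2 ?_
  rw [Submodule.mem_orthogonal]
  intro u hu
  induction hu using Submodule.span_induction with
  | mem u hu =>
    simp only [Finset.coe_image, Set.mem_image, SetLike.mem_coe] at hu
    obtain ⟨j, hj, rfl⟩ := hu
    rw [inner_delta, delta_apply, if_neg]
    rintro rfl
    exact hi hj
  | zero => simp
  | add u v _ _ hu hv => simp [inner_add_left, hu, hv]
  | smul c u _ hu => simp [inner_smul_left, hu]

theorem proj_apply (S : Finset G) (u : lp (fun _ : G => ℂ) 2) (i : G) :
    proj S u i = if i ∈ S then u i else 0 := by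
  rw [← inner_delta, ← ContinuousLinearMap.adjoint_inner_left,
    ← ContinuousLinearMap.star_eq_adjoint, (isSelfAdjoint_proj S).star_eq]
  split_ifs with h
  · rw [proj_delta_of_mem h, inner_delta]
  · rw [proj_delta_of_notMem h, inner_zero_left]

theorem norm_one_sub_proj_le_one (S : Finset G) : ‖1 - proj S‖ ≤ 1 := by
  have : 1 - proj S = (Submodule.span ℂ
      ((S.image delta : Finset (lp (fun _ : G => ℂ) 2)) : Set _))ᗮ.starProjection := by
    rw [Submodule.starProjection_orthogonal]; rfl
  rw [this]
  exact Submodule.starProjection_norm_le _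

/-- The square of the Hilbert–Schmidt norm of `(1 - P) A P`, where `P` is the projection onto the
sequences supported by `S`. -/
def defect (S : Finset G) (A : lp (fun _ : G => ℂ) 2 →L[ℂ] lp (fun _ : G => ℂ) 2) : ℝ :=
  ∑ i ∈ S, ‖(1 - proj S) (A (delta i))‖ ^ 2

theorem defect_nonneg (S : Finset G) (A : lp (fun _ : G => ℂ) 2 →L[ℂ] lp (fun _ : G => ℂ) 2) :
    0 ≤ defect S A := Finset.sum_nonneg fun _ _ => by positivity

theorem ofReal_defect (S : Finset G) (A : lp (fun _ : G => ℂ) 2 →L[ℂ] lp (fun _ : G => ℂ) 2) :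
    ENNReal.ofReal (defect S A) = hsNormSq ((1 - proj S) * A * proj S) := by
  rw [hsNormSq, tsum_eq_sum (s := S), defect, ENNReal.ofReal_sum_of_nonneg fun _ _ => by positivity]
  · refine Finset.sum_congr rfl fun i hi => ?_
    rw [ENNReal.ofReal_pow (norm_nonneg _), ofReal_norm]
    simp only [mul_apply_eq_comp, proj_delta_of_mem hi]
  · intro i hi
    simp [proj_delta_of_notMem hi]

theorem defect_add_le (S : Finset G) (A B : lp (fun _ : G => ℂ) 2 →L[ℂ] lp (fun _ : G => ℂ) 2) :
    defect S (A + B) ≤ 2 * defect S A + 2 * defect S B := by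
  simp only [defect, Finset.mul_sum, ← Finset.sum_add_distrib]
  refine Finset.sum_le_sum fun i _ => ?_
  rw [add_apply, map_add]
  exact norm_add_sq_le _ _

theorem defect_smul (S : Finset G) (c : ℂ)
    (A : lp (fun _ : G => ℂ) 2 →L[ℂ] lp (fun _ : G => ℂ) 2) :
    defect S (c • A) = ‖c‖ ^ 2 * defect S A := by
  simp only [defect, Finset.mul_sum]
  refine Finset.sum_congr rfl fun i _ => ?_
  rw [smul_apply, map_smul, norm_smul, mul_pow]

theorem defect_le (S : Finset G) (A : lp (fun _ : G => ℂ) 2 →L[ℂ] lp (fun _ : G => ℂ) 2) :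
    defect S A ≤ S.card * ‖A‖ ^ 2 := by
  rw [defect, ← nsmul_eq_mul]
  refine Finset.sum_le_card_nsmul _ _ _ fun i _ => ?_
  gcongr
  calc _ ≤ ‖1 - proj S‖ * ‖A (delta i)‖ := ContinuousLinearMap.le_opNorm _ _
    _ ≤ 1 * (‖A‖ * ‖delta i‖) := by
        gcongr
        · exact norm_one_sub_proj_le_one S
        · exact A.le_opNorm _
    _ = ‖A‖ := by rw [norm_delta]; ring

end HilbertSchmidt

variable {G : Type*} (Γ : WeightedGraph G)

/-- The vector (1 - P) W δ_i vanishes unless i has a neighbour outside S, and its norm is at most 1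
in any case. -/
theorem defect_op_le (S : Finset G) : defect S Γ.op ≤ Γ.boundaryCard S := by
  rw [defect, boundaryCard]
  have hset : {i | i ∈ S ∧ ∃ j, j ∉ S ∧ Γ.W i j ≠ 0} =
      ((S.filter fun i => ∃ j, j ∉ S ∧ Γ.W i j ≠ 0 : Finset G) : Set G) := by
    ext i; simp
  rw [hset, Set.ncard_coe_finset, Finset.card_filter]
  rw [Nat.cast_sum]
  refine Finset.sum_le_sum fun i _ => ?_
  split_ifs with h
  · have : ‖(1 - proj S) (Γ.op (delta i))‖ ≤ 1 := by
      calc _ ≤ ‖1 - proj S‖ * ‖Γ.op (delta i)‖ := ContinuousLinearMap.le_opNorm _ _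
        _ ≤ 1 * (‖Γ.op‖ * ‖delta i‖) := by
            gcongr
            · exact norm_one_sub_proj_le_one S
            · exact Γ.op.le_opNorm _
        _ ≤ 1 * (1 * 1) := by
            gcongr
            · exact Γ.norm_op_le_one
            · exact (norm_delta i).le
        _ = 1 := by norm_num
    exact (pow_le_one₀ (norm_nonneg _) this).trans_eq (by simp)
  · push Not at h
    have : (1 - proj S) (Γ.op (delta i)) = 0 := by
      ext j
      have e : (1 - proj S) (Γ.op (delta i)) j = Γ.op (delta i) j - proj S (Γ.op (delta i)) j := rfl
      rw [e, proj_apply, op_delta_apply, Γ.symm j i]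
      split_ifs with hj
      · simp
      · simp [h j hj]
    rw [this]
    simp

theorem norm_op_pow_le_one (k : ℕ) : ‖Γ.op ^ k‖ ≤ 1 := by
  induction k with
  | zero => exact ContinuousLinearMap.norm_id_le
  | succ k ih =>
    rw [pow_succ]
    exact (norm_mul_le _ _).trans (mul_le_one₀ ih (norm_nonneg _) Γ.norm_op_le_one)

/-- Inserting P + (1 - P) after the leading factor W splits (1 - P) W^(k+1) P into a part containing
(1 - P) W P and a part containing (1 - P) W^k P, the other factors being contractions. The constant
depends on k but not on S. -/
theorem exists_defect_pow_le (k : ℕ) :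
    ∃ C : ℝ, ∀ S : Finset G, defect S (Γ.op ^ k) ≤ C * Γ.boundaryCard S := by
  induction k with
  | zero =>
    refine ⟨0, fun S => ?_⟩
    rw [defect, Finset.sum_eq_zero, zero_mul]
    intro i hi
    have : (1 - proj S) ((Γ.op ^ 0) (delta i)) = delta i - proj S (delta i) := rfl
    rw [this, proj_delta_of_mem hi]
    simp
  | succ k ih =>
    obtain ⟨C, hC⟩ := ih
    refine ⟨2 * 1 + 2 * C, fun S => ?_⟩
    have hb := Γ.defect_op_le S
    have key : defect S (Γ.op ^ (k + 1)) ≤ 2 * defect S Γ.op + 2 * defect S (Γ.op ^ k) := by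
      have h0 := defect_nonneg S Γ.op
      have h1 := defect_nonneg S (Γ.op ^ k)
      rw [← ENNReal.ofReal_le_ofReal_iff (by positivity),
        ENNReal.ofReal_add (by positivity) (by positivity), ENNReal.ofReal_mul zero_le_two,
        ENNReal.ofReal_mul zero_le_two]
      simp only [ofReal_defect, ENNReal.ofReal_ofNat]
      have e : (1 - proj S) * Γ.op ^ (k + 1) * proj S =
          (1 - proj S) * Γ.op * proj S * (Γ.op ^ k * proj S) +
            (1 - proj S) * Γ.op * ((1 - proj S) * Γ.op ^ k * proj S) := by
        rw [pow_succ']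
        noncomm_ring
      rw [e]
      refine (hsNormSq_add_le _ _).trans ?_
      gcongr
      · refine hsNormSq_mul_le_of_norm_le_one' ?_
        exact (norm_mul_le _ _).trans
          (mul_le_one₀ (Γ.norm_op_pow_le_one k) (norm_nonneg _) (norm_proj_le_one S))
      · refine hsNormSq_mul_le_of_norm_le_one ?_
        exact (norm_mul_le _ _).trans
          (mul_le_one₀ (norm_one_sub_proj_le_one S) (norm_nonneg _) Γ.norm_op_le_one)
    have := hC S
    nlinarith

/-! ### Asymptotic multiplicativity of compressions. -/

section Asymptotics

variable {V : ℕ → Finset G}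

/-- Monomials are handled by `exists_defect_pow_le`. A uniform polynomial approximation extends the
result to continuous functions, because `defect_le` bounds the error by m times a squared operator
norm. -/
theorem tendsto_defect_div (hcard : Tendsto (fun n => (V n).card) atTop atTop)
    (hboundary : (fun n => (Γ.boundaryCard (V n) : ℝ)) =o[atTop] fun n => ((V n).card : ℝ))
    {g : ℝ → ℝ} (hg : ContinuousOn g Γ.Sp) :
    Tendsto (fun n => defect (V n) (operatorFunction Γ.op g) / (V n).card) atTop (𝓝 0) := by
  have hb : Tendsto (fun n => (Γ.boundaryCard (V n) : ℝ) / (V n).card) atTop (𝓝 0) :=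
    hboundary.tendsto_div_nhds_zero
  have hpoly : ∀ p : Polynomial ℝ, Tendsto (fun n =>
      defect (V n) (operatorFunction Γ.op fun x => p.eval x) / (V n).card) atTop (𝓝 0) := by
    intro p
    induction p using Polynomial.induction_on' with
    | add p q hp hq =>
      refine squeeze_zero (fun n => div_nonneg (defect_nonneg _ _) (by positivity)) (fun n => ?_)
        (by simpa using (hp.const_mul 2).add (hq.const_mul 2))
      simp only [Polynomial.eval_add]
      rw [operatorFunction_add p.continuous.continuousOn q.continuous.continuousOn,
        ← mul_div_assoc, ← mul_div_assoc, ← add_div]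
      gcongr
      exact defect_add_le _ _ _
    | monomial k c =>
      obtain ⟨C, hC⟩ := Γ.exists_defect_pow_le k
      refine squeeze_zero (fun n => div_nonneg (defect_nonneg _ _) (by positivity)) (fun n => ?_)
        (by simpa only [mul_zero] using hb.const_mul (‖(c : ℂ)‖ ^ 2 * C))
      simp only [Polynomial.eval_monomial]
      rw [operatorFunction_monomial Γ.isSelfAdjoint_op, defect_smul, ← mul_div_assoc, mul_assoc]
      exact div_le_div_of_nonneg_right (mul_le_mul_of_nonneg_left (hC _) (sq_nonneg _))
        (by positivity)
  rw [Metric.tendsto_atTop]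
  intro ε hε
  -- The polynomial and the remainder each contribute at most 2 · ε/8 after normalization, for a
  -- total of at most ε/2.
  obtain ⟨p, hp⟩ := Γ.exists_polynomial_near hg (ε := √(ε / 8)) (by positivity)
  obtain ⟨N, hN⟩ := (Metric.tendsto_atTop.1 (hpoly p)) (ε / 8) (by positivity)
  obtain ⟨N', hN'⟩ := eventually_atTop.1 (hcard.eventually_gt_atTop 0)
  refine ⟨max N N', fun n hn => ?_⟩
  have h1 := hN n (le_of_max_le_left hn)
  have h0 : (0 : ℝ) < (V n).card := by exact_mod_cast hN' n (le_of_max_le_right hn)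
  rw [Real.dist_eq, sub_zero, abs_of_nonneg (div_nonneg (defect_nonneg _ _) h0.le)] at h1 ⊢
  rw [div_lt_iff₀ h0] at h1 ⊢
  have h2 := defect_add_le (V n) (operatorFunction Γ.op fun x => p.eval x)
    (operatorFunction Γ.op fun x => g x - p.eval x)
  rw [operatorFunction_sub hg p.continuous.continuousOn, add_sub_cancel] at h2
  have h3 := defect_le (V n) (operatorFunction Γ.op fun x => g x - p.eval x)
  rw [operatorFunction_sub hg p.continuous.continuousOn] at h3
  have h4 : ‖operatorFunction Γ.op g - operatorFunction Γ.op fun x => p.eval x‖ ^ 2 ≤ ε / 8 := by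
    rw [← operatorFunction_sub hg p.continuous.continuousOn, ← Real.sq_sqrt (by positivity : 0 ≤ ε / 8)]
    gcongr
    exact norm_operatorFunction_le_of_forall (by positivity) hp
  nlinarith

theorem proj_eq_sum (S : Finset G) (u : lp (fun _ : G => ℂ) 2) :
    proj S u = ∑ k : S, u k • delta (k : G) := by
  ext i
  rw [proj_apply, lp.coeFn_sum, Finset.sum_apply]
  simp only [lp.coeFn_smul, Pi.smul_apply, delta_apply, smul_eq_mul, mul_ite, mul_one, mul_zero]
  rw [Finset.sum_coe_sort S fun k => if i = k then u k else 0, Finset.sum_ite_eq]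

/-- Since P = 1 - (1 - P), replacing P by 1 in the middle of P g(W) P h(W) P costs exactly -P g(W)
(1 - P) h(W) P. -/
theorem Kmat_mul_Kmat_sub_apply (S : Finset G) {g h : ℝ → ℝ} (hg : ContinuousOn g Γ.Sp)
    (hh : ContinuousOn h Γ.Sp) (i j : S) :
    (((Γ.Kmat S g * Γ.Kmat S h - Γ.Kmat S fun x => g x * h x) i j : ℝ) : ℂ) =
      -(operatorFunction Γ.op g
        ((1 - proj S) (operatorFunction Γ.op h (delta (j : G)))) (i : G)) := by
  have e : (1 - proj S) (operatorFunction Γ.op h (delta (j : G))) =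
      operatorFunction Γ.op h (delta (j : G)) - proj S (operatorFunction Γ.op h (delta (j : G))) :=
    rfl
  have hgh : ContinuousOn (fun x => g x * h x) Γ.Sp := hg.mul hh
  have e2 : operatorFunction Γ.op g (operatorFunction Γ.op h (delta (j : G))) =
      operatorFunction Γ.op (fun x => g x * h x) (delta (j : G)) := by
    rw [operatorFunction_mul hg hh]; rfl
  rw [e, map_sub, e2, lp.coeFn_sub, Pi.sub_apply, Γ.operatorFunction_delta_apply hgh,
    proj_eq_sum, map_sum, lp.coeFn_sum, Finset.sum_apply]
  simp only [map_smul, lp.coeFn_smul, Pi.smul_apply, Γ.operatorFunction_delta_apply hh,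
    Γ.operatorFunction_delta_apply hg]
  simp [Matrix.mul_apply, Kmat_apply, mul_comm]

theorem hsSq_Kmat_mul_sub_le (S : Finset G) {g h : ℝ → ℝ} (hg : ContinuousOn g Γ.Sp)
    (hh : ContinuousOn h Γ.Sp) {C : ℝ} (hC : 0 ≤ C) (hgC : ∀ x ∈ Γ.Sp, |g x| ≤ C) :
    (Γ.Kmat S g * Γ.Kmat S h - Γ.Kmat S fun x => g x * h x).hsSq ≤
      C ^ 2 * defect S (operatorFunction Γ.op h) := by
  rw [Matrix.hsSq, Finset.sum_comm, defect, Finset.mul_sum,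
    ← Finset.sum_coe_sort S fun j =>
      C ^ 2 * ‖(1 - proj S) (operatorFunction Γ.op h (delta j))‖ ^ 2]
  refine Finset.sum_le_sum fun j _ => ?_
  set u := (1 - proj S) (operatorFunction Γ.op h (delta (j : G))) with hu
  calc _ = ∑ i : S, ‖operatorFunction Γ.op g u (i : G)‖ ^ 2 := by
        refine Finset.sum_congr rfl fun i _ => ?_
        have := Γ.Kmat_mul_Kmat_sub_apply S hg hh i j
        rw [← norm_neg, ← this, Complex.norm_real, Real.norm_eq_abs, sq_abs]
    _ ≤ ‖operatorFunction Γ.op g u‖ ^ 2 := sum_norm_sq_apply_le _ _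
    _ ≤ (C * ‖u‖) ^ 2 := by
        gcongr
        exact (ContinuousLinearMap.le_opNorm _ _).trans
          (by gcongr; exact norm_operatorFunction_le_of_forall hC hgC)
    _ = _ := by rw [mul_pow]

end Asymptotics

end WeightedGraph

end

noncomputable section

/-! ### Spectral measures and trace asymptotics -/

section SpectralMeasure

variable {H : Type*} [NormedAddCommGroup H] [InnerProductSpace ℂ H] [CompleteSpace H]

theorem ae_mem_spectrum_spectralMeasure (A : H →L[ℂ] H) (hA : IsSelfAdjoint A) (v : H) :
    ∀ᵐ x ∂spectralMeasure A hA v, x ∈ spectrum ℝ A := by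
  have hm : MeasurableSet (spectrum ℝ A) := (spectrum.isCompact (𝕜 := ℝ) A).isClosed.measurableSet
  rw [spectralMeasure]
  exact (ae_map_iff measurable_subtype_coe.aemeasurable hm).2 (Eventually.of_forall fun x => x.2)

theorem integral_spectralMeasure (A : H →L[ℂ] H) (hA : IsSelfAdjoint A) (v : H) {g : ℝ → ℝ}
    (hg : Continuous g) :
    ∫ x, g x ∂spectralMeasure A hA v = (inner ℂ v (operatorFunction A g v)).re := by
  have : CompactSpace (spectrum ℝ A) := isCompact_iff_compactSpace.1 (spectrum.isCompact (𝕜 := ℝ) A)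
  rw [spectralMeasure, integral_map measurable_subtype_coe.aemeasurable
    hg.aestronglyMeasurable]
  let φ : C_c(spectrum ℝ A, ℝ) :=
    ⟨⟨fun x => g x, hg.comp continuous_subtype_val⟩, HasCompactSupport.of_compactSpace _⟩
  have h := RealRMK.integral_rieszMeasure (spectralFunctional A hA v) φ
  refine h.trans ?_
  rw [operatorFunction, cfc_apply g A hA hg.continuousOn]
  rfl

end SpectralMeasure

namespace WeightedGraph

open scoped Matrix.Norms.L2Operator
open Classical

variable {G : Type*} (Γ : WeightedGraph G)

theorem exists_bound_Sp {g : ℝ → ℝ} (hg : ContinuousOn g Γ.Sp) :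
    ∃ C, 0 ≤ C ∧ ∀ x ∈ Γ.Sp, |g x| ≤ C := by
  obtain ⟨C, hC⟩ := Γ.isCompact_Sp.exists_bound_of_continuousOn hg
  exact ⟨max C 0, le_max_right _ _, fun x hx => (hC x hx).trans (le_max_left _ _)⟩

theorem trace_Kmat (S : Finset G) (g : BoundedContinuousFunction ℝ ℝ) :
    (Γ.Kmat S g).trace / S.card = ∫ x, g x ∂(Γ.avgMeasure S : Measure ℝ) := by
  have h : (Γ.avgMeasure S : Measure ℝ) = (S.card : ℝ≥0)⁻¹ • ∑ i ∈ S,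
      spectralMeasure Γ.op Γ.isSelfAdjoint_op (delta i) := by
    rw [avgMeasure, FiniteMeasure.toMeasure_smul, FiniteMeasure.toMeasure_sum]
    rfl
  rw [h, integral_smul_nnreal_measure, integral_finsetSum_measure fun i _ => g.integrable _]
  simp only [integral_spectralMeasure _ _ _ g.continuous]
  rw [Matrix.trace, div_eq_inv_mul, NNReal.smul_def, smul_eq_mul]
  simp only [Matrix.diag_apply, Kmat_apply, K]
  rw [Finset.sum_coe_sort S fun i => (inner ℂ (delta i) (operatorFunction Γ.op g (delta i))).re]
  simp

theorem ae_mem_Sp_avgMeasure (S : Finset G) : ∀ᵐ x ∂(Γ.avgMeasure S : Measure ℝ), x ∈ Γ.Sp := by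
  have h : (Γ.avgMeasure S : Measure ℝ) = (S.card : ℝ≥0)⁻¹ • ∑ i ∈ S,
      spectralMeasure Γ.op Γ.isSelfAdjoint_op (delta i) := by
    rw [avgMeasure, FiniteMeasure.toMeasure_smul, FiniteMeasure.toMeasure_sum]
    rfl
  rw [h]
  refine Measure.ae_smul_measure ?_ _
  rw [ae_iff, Measure.finsetSum_apply]
  exact Finset.sum_eq_zero fun i _ => ae_mem_spectrum_spectralMeasure _ _ _

/-! ### Negligible Hilbert–Schmidt errors and limits of normalized traces. -/

section Asymptotics

variable {Γ} {V : ℕ → Finset G} {μ : FiniteMeasure ℝ}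

/-- Weak limits of measures carried by the closed set Sp(W) are carried by it: test with the
truncated distance to Sp(W). -/
theorem ae_mem_Sp (hμ : Tendsto (fun n => Γ.avgMeasure (V n)) atTop (𝓝 μ)) :
    ∀ᵐ x ∂(μ : Measure ℝ), x ∈ Γ.Sp := by
  -- The distance to the empty set is 0 by convention and would detect nothing, so an empty spectrum
  -- is treated apart.
  rcases Γ.Sp.eq_empty_or_nonempty with h0 | h0
  · have : ∀ n, Γ.avgMeasure (V n) = 0 := fun n => by
      have h := Γ.ae_mem_Sp_avgMeasure (V n)
      simp only [h0, Set.mem_empty_iff_false, ae_iff, not_false_eq_true, Set.ofPred_true,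
        Measure.measure_univ_eq_zero] at h
      exact Subtype.ext h
    simp only [this] at hμ
    rw [tendsto_nhds_unique hμ tendsto_const_nhds]
    simp
  · let g : BoundedContinuousFunction ℝ ℝ := BoundedContinuousFunction.mkOfBound
      ⟨fun x => min 1 (Metric.infDist x Γ.Sp), by fun_prop⟩ 2 (fun x y => by
        have hb : ∀ z, 0 ≤ min 1 (Metric.infDist z Γ.Sp) ∧ min 1 (Metric.infDist z Γ.Sp) ≤ 1 :=
          fun z => ⟨le_min zero_le_one Metric.infDist_nonneg, min_le_left _ _⟩
        rw [Real.dist_eq]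
        have h1 := hb x
        have h2 := hb y
        simp only [ContinuousMap.coe_mk]
        exact _root_.abs_le.2 ⟨by linarith [h1.1, h2.2], by linarith [h1.2, h2.1]⟩)
    have hg : ∀ x, g x = min 1 (Metric.infDist x Γ.Sp) := fun x => rfl
    have hlim := FiniteMeasure.tendsto_iff_forall_integral_tendsto.1 hμ g
    have hz : ∀ n, ∫ x, g x ∂(Γ.avgMeasure (V n) : Measure ℝ) = 0 := fun n => by
      refine integral_eq_zero_of_ae ?_
      filter_upwards [Γ.ae_mem_Sp_avgMeasure (V n)] with x hx
      simp [hg, Metric.infDist_zero_of_mem hx]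
    simp only [hz] at hlim
    have h1 : ∫ x, g x ∂(μ : Measure ℝ) = 0 := (tendsto_nhds_unique hlim tendsto_const_nhds)
    have hg0 : 0 ≤ (fun x => g x) := fun x => le_min zero_le_one Metric.infDist_nonneg
    rw [integral_eq_zero_iff_of_nonneg hg0 (g.integrable _)] at h1
    filter_upwards [h1] with x hx
    rw [Γ.isCompact_Sp.isClosed.mem_iff_infDist_zero h0]
    have hx' : min 1 (Metric.infDist x Γ.Sp) = 0 := hx
    rcases min_choice 1 (Metric.infDist x Γ.Sp) with h | h
    · rw [h] at hx'; norm_num at hx'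
    · rwa [h] at hx'

theorem integrable_of_continuousOn_Sp (hμ : Tendsto (fun n => Γ.avgMeasure (V n)) atTop (𝓝 μ))
    {g : ℝ → ℝ} (hg : ContinuousOn g Γ.Sp) : Integrable g (μ : Measure ℝ) := by
  obtain ⟨g', hg'⟩ := Γ.exists_boundedContinuous_eqOn hg
  refine (g'.integrable (μ : Measure ℝ)).congr ?_
  filter_upwards [ae_mem_Sp hμ] with x hx using (hg' hx).symm

theorem integrable_eval (hμ : Tendsto (fun n => Γ.avgMeasure (V n)) atTop (𝓝 μ))
    {g : ℝ → ℝ} (hg : ContinuousOn g Γ.Sp) (p : Polynomial ℝ) :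
    Integrable (fun x => p.eval (g x)) (μ : Measure ℝ) :=
  integrable_of_continuousOn_Sp hμ (p.continuous.comp_continuousOn hg)

theorem tendsto_trace_Kmat (hμ : Tendsto (fun n => Γ.avgMeasure (V n)) atTop (𝓝 μ))
    {g : ℝ → ℝ} (hg : ContinuousOn g Γ.Sp) :
    Tendsto (fun n => (Γ.Kmat (V n) g).trace / (V n).card) atTop
      (𝓝 (∫ x, g x ∂(μ : Measure ℝ))) := by
  obtain ⟨g', hg'⟩ := Γ.exists_boundedContinuous_eqOn hg
  have hint : ∫ x, g x ∂(μ : Measure ℝ) = ∫ x, g' x ∂(μ : Measure ℝ) :=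
    integral_congr_ae <| by filter_upwards [ae_mem_Sp hμ] with x hx using hg' hx
  simp only [Γ.Kmat_congr _ hg', trace_Kmat, hint]
  exact FiniteMeasure.tendsto_iff_forall_integral_tendsto.1 hμ g'

/-- A sequence of matrices whose Hilbert–Schmidt norms are negligible with respect to the square
root of the size. -/
def HSNegligible (M : ∀ n, Matrix (V n) (V n) ℝ) : Prop :=
  Tendsto (fun n => (M n).hsSq / (V n).card) atTop (𝓝 0)

theorem HSNegligible.of_le {M : ∀ n, Matrix (V n) (V n) ℝ} {F : ℕ → ℝ}
    (h : ∀ n, (M n).hsSq / (V n).card ≤ F n) (hF : Tendsto F atTop (𝓝 0)) : HSNegligible M :=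
  squeeze_zero (fun n => div_nonneg (M n).hsSq_nonneg (by positivity)) h hF

theorem HSNegligible.add {M N : ∀ n, Matrix (V n) (V n) ℝ} (hM : HSNegligible M)
    (hN : HSNegligible N) : HSNegligible fun n => M n + N n := by
  refine .of_le (fun n => ?_) (by simpa using (Tendsto.const_mul 2 hM).add (Tendsto.const_mul 2 hN))
  rw [← mul_div_assoc, ← mul_div_assoc, ← add_div]
  gcongr
  exact Matrix.hsSq_add_le _ _

theorem HSNegligible.mul_left {M N : ∀ n, Matrix (V n) (V n) ℝ} {C : ℝ} (hM : ∀ n, ‖M n‖ ≤ C)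
    (hN : HSNegligible N) : HSNegligible fun n => M n * N n := by
  refine .of_le (fun n => ?_) (by simpa using Tendsto.const_mul (C ^ 2) hN)
  rw [← mul_div_assoc]
  gcongr
  refine (Matrix.hsSq_mul_le _ _).trans ?_
  gcongr
  · exact Matrix.hsSq_nonneg _
  · exact hM n

theorem HSNegligible.mul_right {M N : ∀ n, Matrix (V n) (V n) ℝ} {C : ℝ} (hN : ∀ n, ‖N n‖ ≤ C)
    (hM : HSNegligible M) : HSNegligible fun n => M n * N n := by
  refine .of_le (fun n => ?_) (by simpa using Tendsto.const_mul (C ^ 2) hM)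
  rw [← mul_div_assoc]
  gcongr
  refine (Matrix.hsSq_mul_le' _ _).trans ?_
  gcongr
  · exact Matrix.hsSq_nonneg _
  · exact hN n

theorem HSNegligible.tendsto_trace {M : ∀ n, Matrix (V n) (V n) ℝ} (hM : HSNegligible M) :
    Tendsto (fun n => (M n).trace / (V n).card) atTop (𝓝 0) := by
  have h : Tendsto (fun n => √((M n).hsSq / (V n).card)) atTop (𝓝 0) := by
    simpa only [Real.sqrt_zero, Function.comp_def] using (Real.continuous_sqrt.tendsto 0).comp hM
  refine squeeze_zero_norm (fun n => ?_) h
  rw [Real.norm_eq_abs]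
  refine Real.abs_le_sqrt ?_
  -- For an empty vertex set both quotients are divisions by zero, hence equal to 0.
  rcases (V n).card.eq_zero_or_pos with h0 | h0
  · simp [h0]
  · have h0' : (0 : ℝ) < (V n).card := by exact_mod_cast h0
    have := (M n).trace_sq_le
    rw [Fintype.card_coe] at this
    rw [div_pow, div_le_div_iff₀ (by positivity) h0']
    nlinarith

theorem HSNegligible.tendsto_trace_of_sub {M N : ∀ n, Matrix (V n) (V n) ℝ}
    (hMN : HSNegligible fun n => M n - N n) {l : ℝ}
    (hN : Tendsto (fun n => (N n).trace / (V n).card) atTop (𝓝 l)) :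
    Tendsto (fun n => (M n).trace / (V n).card) atTop (𝓝 l) := by
  have := hMN.tendsto_trace.add hN
  rw [zero_add] at this
  refine this.congr fun n => ?_
  rw [Matrix.trace_sub]
  ring

theorem hsNegligible_Kmat_mul (hcard : Tendsto (fun n => (V n).card) atTop atTop)
    (hboundary : (fun n => (Γ.boundaryCard (V n) : ℝ)) =o[atTop] fun n => ((V n).card : ℝ))
    {g h : ℝ → ℝ} (hg : ContinuousOn g Γ.Sp) (hh : ContinuousOn h Γ.Sp) :
    HSNegligible fun n => Γ.Kmat (V n) g * Γ.Kmat (V n) h - Γ.Kmat (V n) fun x => g x * h x := by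
  obtain ⟨C, hC, hgC⟩ := Γ.exists_bound_Sp hg
  refine .of_le (fun n => ?_)
    (by simpa using (Γ.tendsto_defect_div hcard hboundary hh).const_mul (C ^ 2))
  rw [← mul_div_assoc]
  gcongr
  exact Γ.hsSq_Kmat_mul_sub_le (V n) hg hh hC hgC

theorem hsNegligible_zero : HSNegligible fun n => (0 : Matrix (V n) (V n) ℝ) := by
  simp [HSNegligible, Matrix.hsSq]

/-- The error for k + 1 is K_n(g) times the error for k, plus the error of the product g · g^k; a
factor bounded in operator norm preserves negligibility. -/
theorem hsNegligible_Kmat_pow (hcard : Tendsto (fun n => (V n).card) atTop atTop)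
    (hboundary : (fun n => (Γ.boundaryCard (V n) : ℝ)) =o[atTop] fun n => ((V n).card : ℝ))
    {g : ℝ → ℝ} (hg : ContinuousOn g Γ.Sp) (k : ℕ) :
    HSNegligible fun n => Γ.Kmat (V n) g ^ k - Γ.Kmat (V n) fun x => g x ^ k := by
  induction k with
  | zero =>
    simp only [pow_zero, Kmat_const, one_smul, sub_self]
    exact hsNegligible_zero
  | succ k ih =>
    obtain ⟨C, hC, hgC⟩ := Γ.exists_bound_Sp hg
    have h1 := ih.mul_left (M := fun n => Γ.Kmat (V n) g) (fun n => Γ.norm_Kmat_le (V n) hg hC hgC)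
    have h2 := hsNegligible_Kmat_mul hcard hboundary hg (h := fun x => g x ^ k) (hg.pow k)
    convert h1.add h2 using 2 with n
    simp only [pow_succ', mul_sub, sub_add_sub_cancel]

theorem tendsto_trace_aeval (hcard : Tendsto (fun n => (V n).card) atTop atTop)
    (hboundary : (fun n => (Γ.boundaryCard (V n) : ℝ)) =o[atTop] fun n => ((V n).card : ℝ))
    (hμ : Tendsto (fun n => Γ.avgMeasure (V n)) atTop (𝓝 μ))
    {g : ℝ → ℝ} (hg : ContinuousOn g Γ.Sp) (p : Polynomial ℝ) :
    Tendsto (fun n => (Polynomial.aeval (Γ.Kmat (V n) g) p).trace / (V n).card) atTop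
      (𝓝 (∫ x, p.eval (g x) ∂(μ : Measure ℝ))) := by
  induction p using Polynomial.induction_on' with
  | add p q hp hq =>
    simp only [Polynomial.eval_add, map_add, Matrix.trace_add, add_div]
    rw [integral_add (integrable_eval hμ hg p) (integrable_eval hμ hg q)]
    exact hp.add hq
  | monomial k c =>
    have h := (hsNegligible_Kmat_pow hcard hboundary hg k).tendsto_trace_of_sub
      (tendsto_trace_Kmat hμ (hg.pow k))
    simp only [Polynomial.eval_monomial, Polynomial.aeval_monomial, integral_const_mul,
      ← Algebra.smul_def, Matrix.trace_smul, smul_eq_mul, mul_div_assoc]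
    exact h.const_mul c

/-- The eigenvalues of K_n(f) stay in [c, C], where the logarithm is uniformly close to a
polynomial; log det is then close to the trace of that polynomial of K_n(f), whose limit is known.
-/
theorem tendsto_log_det_Kmat (hcard : Tendsto (fun n => (V n).card) atTop atTop)
    (hboundary : (fun n => (Γ.boundaryCard (V n) : ℝ)) =o[atTop] fun n => ((V n).card : ℝ))
    (hμ : Tendsto (fun n => Γ.avgMeasure (V n)) atTop (𝓝 μ))
    {f : ℝ → ℝ} (hf : ContinuousOn f Γ.Sp) {c C : ℝ} (hc : 0 < c) (hC : 0 ≤ C)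
    (hfc : ∀ x ∈ Γ.Sp, c ≤ f x) (hfC : ∀ x ∈ Γ.Sp, f x ≤ C) :
    Tendsto (fun n => Real.log (Γ.Kmat (V n) f).det / (V n).card) atTop
      (𝓝 (∫ x, Real.log (f x) ∂(μ : Measure ℝ))) := by
  have hlog : ContinuousOn (fun x => Real.log (f x)) Γ.Sp :=
    hf.log fun x hx => (hc.trans_le (hfc x hx)).ne'
  rw [Metric.tendsto_atTop]
  intro ε hε
  set M : ℝ := (μ : Measure ℝ).real Set.univ with hM
  -- The three errors, from the determinant, the trace limit and the integral, are at most η, η and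
  -- ηM, with sum ε/2.
  set η : ℝ := ε / (2 * (M + 2)) with hη
  have hM0 : 0 ≤ M := measureReal_nonneg
  have hη0 : 0 < η := by positivity
  obtain ⟨p, hp⟩ := exists_polynomial_near_of_continuousOn c C Real.log
    (Real.continuousOn_log.mono fun x hx => (hc.trans_le hx.1).ne') η hη0
  have hp' : ∀ t ∈ Set.Icc c C, |Real.log t - p.eval t| ≤ η := fun t ht => by
    rw [abs_sub_comm]; exact (hp t ht).le
  obtain ⟨N, hN⟩ := Metric.tendsto_atTop.1 (tendsto_trace_aeval hcard hboundary hμ hf p) η hη0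
  obtain ⟨N', hN'⟩ := eventually_atTop.1 (hcard.eventually_gt_atTop 0)
  refine ⟨max N N', fun n hn => ?_⟩
  have h1 := hN n (le_of_max_le_left hn)
  have h0 : (0 : ℝ) < (V n).card := by exact_mod_cast hN' n (le_of_max_le_right hn)
  have h2 := Matrix.abs_log_det_sub_trace_aeval_le (Γ.isHermitian_Kmat (V n) f) hc
    (Γ.le_dotProduct_Kmat (V n) hf hfc)
    (Γ.norm_Kmat_le (V n) hf hC fun x hx => by
      rw [abs_of_pos (hc.trans_le (hfc x hx))]; exact hfC x hx) hp'
  rw [Fintype.card_coe] at h2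
  have h2' : |Real.log (Γ.Kmat (V n) f).det / (V n).card -
      (Polynomial.aeval (Γ.Kmat (V n) f) p).trace / (V n).card| ≤ η := by
    rw [← sub_div, abs_div, abs_of_pos h0, div_le_iff₀ h0, mul_comm]
    exact h2
  have h3 : |∫ x, p.eval (f x) ∂(μ : Measure ℝ) - ∫ x, Real.log (f x) ∂(μ : Measure ℝ)| ≤ η * M := by
    rw [← integral_sub (integrable_eval hμ hf p)
      (integrable_of_continuousOn_Sp hμ hlog), ← Real.norm_eq_abs]
    refine norm_integral_le_of_norm_le_const ?_
    filter_upwards [ae_mem_Sp hμ] with x hx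
    rw [Real.norm_eq_abs]
    exact (hp _ ⟨hfc x hx, hfC x hx⟩).le
  rw [Real.dist_eq] at h1 ⊢
  have hfin : η + η + η * M < ε := by
    have : η * (2 * (M + 2)) = ε := by rw [hη]; field_simp
    nlinarith
  calc _ ≤ |Real.log (Γ.Kmat (V n) f).det / (V n).card -
        (Polynomial.aeval (Γ.Kmat (V n) f) p).trace / (V n).card| +
        |(Polynomial.aeval (Γ.Kmat (V n) f) p).trace / (V n).card -
          ∫ x, p.eval (f x) ∂(μ : Measure ℝ)| +
        |∫ x, p.eval (f x) ∂(μ : Measure ℝ) - ∫ x, Real.log (f x) ∂(μ : Measure ℝ)| :=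
      (abs_sub_le _ _ _).trans (add_le_add_left (abs_sub_le _ _ _) _)
    _ < ε := by linarith

/-- With F = K_n(f), the difference is -F⁻¹ (F K_n(1/f) - 1). The last factor is a multiplicativity
error, since f · (1/f) = 1 on the spectrum, and F⁻¹ has norm at most c⁻¹. -/
theorem hsNegligible_Kmat_inv (hcard : Tendsto (fun n => (V n).card) atTop atTop)
    (hboundary : (fun n => (Γ.boundaryCard (V n) : ℝ)) =o[atTop] fun n => ((V n).card : ℝ))
    {f : ℝ → ℝ} (hf : ContinuousOn f Γ.Sp) {c : ℝ} (hc : 0 < c) (hfc : ∀ x ∈ Γ.Sp, c ≤ f x) :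
    HSNegligible fun n => (Γ.Kmat (V n) f)⁻¹ - Γ.Kmat (V n) fun x => 1 / f x := by
  have hinv : ContinuousOn (fun x => 1 / f x) Γ.Sp :=
    continuousOn_const.div hf fun x hx => (hc.trans_le (hfc x hx)).ne'
  have h1 := hsNegligible_Kmat_mul hcard hboundary hf hinv
  have h2 := h1.mul_left (M := fun n => -(Γ.Kmat (V n) f)⁻¹) (C := c⁻¹) fun n => by
    rw [norm_neg]
    exact Matrix.norm_inv_le (Γ.isHermitian_Kmat (V n) f) hc (Γ.le_dotProduct_Kmat (V n) hf hfc)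
  convert h2 using 2 with n
  have hu : IsUnit (Γ.Kmat (V n) f).det :=
    (Matrix.posDef_of_le (Γ.isHermitian_Kmat (V n) f) hc
      (Γ.le_dotProduct_Kmat (V n) hf hfc)).det_pos.ne'.isUnit
  have e : (Γ.Kmat (V n) fun x => f x * (1 / f x)) = 1 := by
    rw [Γ.Kmat_congr (V n) (h := fun _ => 1) fun x hx =>
      mul_one_div_cancel (hc.trans_le (hfc x hx)).ne', Kmat_const, one_smul]
  rw [e, mul_sub, neg_mul, ← mul_assoc, Matrix.nonsing_inv_mul _ hu]
  simp [sub_eq_add_neg, add_comm]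

theorem tendsto_trace_Kmat_mul (hcard : Tendsto (fun n => (V n).card) atTop atTop)
    (hboundary : (fun n => (Γ.boundaryCard (V n) : ℝ)) =o[atTop] fun n => ((V n).card : ℝ))
    (hμ : Tendsto (fun n => Γ.avgMeasure (V n)) atTop (𝓝 μ))
    {g h : ℝ → ℝ} (hg : ContinuousOn g Γ.Sp) (hh : ContinuousOn h Γ.Sp) :
    Tendsto (fun n => (Γ.Kmat (V n) g * Γ.Kmat (V n) h).trace / (V n).card) atTop
      (𝓝 (∫ x, g x * h x ∂(μ : Measure ℝ))) :=
  (hsNegligible_Kmat_mul hcard hboundary hg hh).tendsto_trace_of_sub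
    (tendsto_trace_Kmat hμ (hg.mul hh))

theorem tendsto_trace_Kmat_inv_mul (hcard : Tendsto (fun n => (V n).card) atTop atTop)
    (hboundary : (fun n => (Γ.boundaryCard (V n) : ℝ)) =o[atTop] fun n => ((V n).card : ℝ))
    (hμ : Tendsto (fun n => Γ.avgMeasure (V n)) atTop (𝓝 μ))
    {f h : ℝ → ℝ} (hf : ContinuousOn f Γ.Sp) {c : ℝ} (hc : 0 < c) (hfc : ∀ x ∈ Γ.Sp, c ≤ f x)
    (hh : ContinuousOn h Γ.Sp) :
    Tendsto (fun n => ((Γ.Kmat (V n) f)⁻¹ * Γ.Kmat (V n) h).trace / (V n).card) atTop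
      (𝓝 (∫ x, 1 / f x * h x ∂(μ : Measure ℝ))) := by
  have hinv : ContinuousOn (fun x => 1 / f x) Γ.Sp :=
    continuousOn_const.div hf fun x hx => (hc.trans_le (hfc x hx)).ne'
  obtain ⟨C, hC, hhC⟩ := Γ.exists_bound_Sp hh
  have h1 := (hsNegligible_Kmat_inv hcard hboundary hf hc hfc).mul_right
    (N := fun n => Γ.Kmat (V n) h) (fun n => Γ.norm_Kmat_le (V n) hh hC hhC)
  simp only [sub_mul] at h1
  exact h1.tendsto_trace_of_sub (tendsto_trace_Kmat_mul hcard hboundary hμ hinv hh)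

end Asymptotics

end WeightedGraph

end

noncomputable section

/-! ### Concentration of Gaussian quadratic forms -/

section Gaussian

/-- The left side is the Laplace transform of Y² - 1 for a standard normal Y; near 0 it is bounded
like that of a Gaussian variable, from log(1 - 2s) ≥ -2s - 8s². -/
theorem exp_neg_mul_inv_sqrt_le {s : ℝ} (hs : |s| ≤ 1 / 4) :
    Real.exp (-s) * (√(1 - 2 * s))⁻¹ ≤ Real.exp (4 * s ^ 2) := by
  have hs' := abs_le.1 hs
  have hu : |2 * s| ≤ 1 / 2 := by rw [abs_mul, abs_two]; linarith
  have h := Real.abs_log_sub_add_sum_range_le (x := 2 * s) (by linarith) 1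
  simp only [Finset.range_one, Finset.sum_singleton, zero_add, pow_one, Nat.cast_zero, div_one] at h
  have h2 : |2 * s| ^ (1 + 1) / (1 - |2 * s|) ≤ 8 * s ^ 2 := by
    rw [div_le_iff₀ (by linarith), one_add_one_eq_two, sq_abs]
    nlinarith [sq_nonneg s]
  have h3 : -(2 * s) - 8 * s ^ 2 ≤ Real.log (1 - 2 * s) := by
    linarith [(abs_le.1 (h.trans h2)).1]
  have h4 : 0 < 1 - 2 * s := by linarith [hs'.2]
  have h5 : Real.exp (-s - 4 * s ^ 2) ≤ √(1 - 2 * s) := by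
    refine Real.le_sqrt_of_sq_le ?_
    rw [← Real.exp_nat_mul, ← Real.le_log_iff_exp_le h4]
    push_cast
    linarith
  rw [← div_eq_mul_inv, div_le_iff₀ (Real.sqrt_pos.2 h4)]
  calc Real.exp (-s) = Real.exp (4 * s ^ 2) * Real.exp (-s - 4 * s ^ 2) := by
        rw [← Real.exp_add]; ring_nf
    _ ≤ _ := by gcongr

theorem gaussianPDFReal_mul_exp_sq (s x : ℝ) :
    gaussianPDFReal 0 1 x * Real.exp (s * (x ^ 2 - 1)) =
      (√(2 * Real.pi))⁻¹ * Real.exp (-s) * Real.exp (-(1 / 2 - s) * x ^ 2) := by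
  rw [gaussianPDFReal_def]
  simp only [NNReal.coe_one, mul_one, sub_zero]
  rw [mul_assoc, mul_assoc, ← Real.exp_add, ← Real.exp_add]
  ring_nf

theorem integrable_exp_sq_gaussianReal {s : ℝ} (hs : s < 1 / 2) :
    Integrable (fun x => Real.exp (s * (x ^ 2 - 1))) (gaussianReal 0 1) := by
  rw [gaussianReal_of_var_ne_zero 0 one_ne_zero,
    integrable_withDensity_iff_integrable_smul' (measurable_gaussianPDF 0 1)
      (ae_of_all _ fun x => gaussianPDF_lt_top)]
  simp only [toReal_gaussianPDF, smul_eq_mul, gaussianPDFReal_mul_exp_sq]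
  exact (integrable_exp_neg_mul_sq (by linarith)).const_mul _

theorem integral_exp_sq_gaussianReal {s : ℝ} (hs : s < 1 / 2) :
    ∫ x, Real.exp (s * (x ^ 2 - 1)) ∂gaussianReal 0 1 = Real.exp (-s) * (√(1 - 2 * s))⁻¹ := by
  rw [integral_gaussianReal_eq_integral_smul one_ne_zero]
  simp only [smul_eq_mul, gaussianPDFReal_mul_exp_sq]
  rw [integral_const_mul, integral_gaussian]
  have h1 : 0 < 1 - 2 * s := by linarith
  have h2 : Real.pi / (1 / 2 - s) = 2 * Real.pi / (1 - 2 * s) := by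
    rw [div_eq_div_iff (by linarith) (by linarith)]; ring
  rw [h2, Real.sqrt_div (by positivity)]
  have : √(2 * Real.pi) ≠ 0 := by positivity
  field_simp

variable {Ω : Type*} [MeasurableSpace Ω] {Pr : Measure Ω} [IsProbabilityMeasure Pr]

/-- Chernoff's bound for a weighted sum of independent centered chi-square variables. -/
theorem measureReal_le_sum_sq_sub_one_le {ι : Type*} [Fintype ι] {Y : ι → Ω → ℝ}
    (hYm : ∀ i, AEMeasurable (Y i) Pr) (hY : ∀ i, Pr.map (Y i) = gaussianReal 0 1)
    (hind : iIndepFun Y Pr) {d : ι → ℝ} {D ε : ℝ} (hε : 0 < ε) (hεD : ε ≤ D)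
    (hd : ∀ i, |d i| ≤ D) :
    Pr.real {ω | ε * Fintype.card ι ≤ ∑ i, d i * (Y i ω ^ 2 - 1)} ≤
      Real.exp (-(ε ^ 2 / (16 * D ^ 2)) * Fintype.card ι) := by
  have hD : 0 < D := hε.trans_le hεD
  -- This t minimizes the exponent -tε + 4t²D² and yields -ε²/(16D²); `hεD` keeps it in the range
  -- where the Laplace transform bound holds.
  set t : ℝ := ε / (8 * D ^ 2) with ht
  have ht0 : 0 < t := by positivity
  have hst : ∀ i, |t * d i| ≤ 1 / 4 := fun i => by
    rw [abs_mul, abs_of_pos ht0]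
    calc t * |d i| ≤ t * D := by gcongr; exact hd i
      _ = ε / (8 * D) := by rw [ht]; field_simp
      _ ≤ 1 / 4 := by rw [div_le_div_iff₀ (by positivity) (by norm_num)]; linarith
  have hlt : ∀ i, t * d i < 1 / 2 := fun i => by linarith [(abs_le.1 (hst i)).2]
  let Z : ι → Ω → ℝ := fun i ω => d i * (Y i ω ^ 2 - 1)
  have hZind : iIndepFun Z Pr :=
    hind.comp (fun i x => d i * (x ^ 2 - 1)) fun i => by fun_prop
  have hZm : ∀ i, AEMeasurable (Z i) Pr := fun i => by
    have := hYm i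
    fun_prop
  have hfun : ∀ i, (fun ω => Real.exp (t * Z i ω)) =
      (fun x => Real.exp (t * d i * (x ^ 2 - 1))) ∘ Y i := fun i => by
    ext ω
    simp only [Z, Function.comp_apply, mul_assoc]
  have hZint : ∀ i, Integrable (fun ω => Real.exp (t * Z i ω)) Pr := fun i => by
    rw [hfun i, ← integrable_map_measure (by fun_prop) (hYm i), hY i]
    exact integrable_exp_sq_gaussianReal (hlt i)
  have hmgf : ∀ i, mgf (Z i) Pr t ≤ Real.exp (4 * (t * D) ^ 2) := fun i => by
    have e : mgf (Z i) Pr t = ∫ x, Real.exp (t * d i * (x ^ 2 - 1)) ∂gaussianReal 0 1 := by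
      rw [mgf, ← hY i, integral_map (hYm i) (by fun_prop)]
      exact integral_congr_ae (ae_of_all _ fun ω => congrFun (hfun i) ω)
    rw [e, integral_exp_sq_gaussianReal (hlt i)]
    refine (exp_neg_mul_inv_sqrt_le (hst i)).trans ?_
    refine Real.exp_le_exp.2 (mul_le_mul_of_nonneg_left ?_ (by norm_num))
    rw [← sq_abs, abs_mul, abs_of_pos ht0]
    have := hd i
    gcongr
  have hsum := hZind.mgf_sum₀ hZm (t := t) Finset.univ
  have hpos : 0 < mgf (∑ i, Z i) Pr t := by
    rw [hsum]
    exact Finset.prod_pos fun i _ => mgf_pos (hZint i)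
  -- The product formula shows that the moment generating function is positive, while it takes the
  -- default value 0 when the exponential is not integrable.
  have hint : Integrable (fun ω => Real.exp (t * (∑ i, Z i) ω)) Pr := by
    by_contra h
    rw [mgf_undef h] at hpos
    exact lt_irrefl _ hpos
  have hch := measure_ge_le_exp_mul_mgf (ε * Fintype.card ι) ht0.le hint
  have hset : {ω | ε * Fintype.card ι ≤ ∑ i, d i * (Y i ω ^ 2 - 1)} =
      {ω | ε * Fintype.card ι ≤ (∑ i, Z i) ω} := by
    ext ω
    simp [Z]
  rw [hset]
  refine hch.trans ?_
  have hprod : mgf (∑ i, Z i) Pr t ≤ Real.exp (4 * (t * D) ^ 2) ^ Fintype.card ι := by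
    rw [hsum, ← Finset.card_univ, ← Finset.prod_const]
    exact Finset.prod_le_prod (fun i _ => mgf_nonneg) fun i _ => hmgf i
  calc _ ≤ Real.exp (-t * (ε * Fintype.card ι)) * Real.exp (4 * (t * D) ^ 2) ^ Fintype.card ι := by
        gcongr
    _ = _ := by
        rw [← Real.exp_nat_mul, ← Real.exp_add, ht]
        congr 1
        field_simp
        ring

theorem measure_le_abs_sum_sq_sub_one_le {ι : Type*} [Fintype ι] {Y : ι → Ω → ℝ}
    (hYm : ∀ i, AEMeasurable (Y i) Pr) (hY : ∀ i, Pr.map (Y i) = gaussianReal 0 1)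
    (hind : iIndepFun Y Pr) {d : ι → ℝ} {D ε : ℝ} (hε : 0 < ε) (hεD : ε ≤ D)
    (hd : ∀ i, |d i| ≤ D) :
    Pr {ω | ε * Fintype.card ι ≤ |∑ i, d i * (Y i ω ^ 2 - 1)|} ≤
      ENNReal.ofReal (2 * Real.exp (-(ε ^ 2 / (16 * D ^ 2)) * Fintype.card ι)) := by
  have h1 := measureReal_le_sum_sq_sub_one_le hYm hY hind hε hεD hd
  have h2 := measureReal_le_sum_sq_sub_one_le hYm hY hind hε hεD (d := fun i => -d i)
    (fun i => by rw [abs_neg]; exact hd i)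
  rw [← ofReal_measureReal]
  refine ENNReal.ofReal_le_ofReal ?_
  have hsub : {ω | ε * Fintype.card ι ≤ |∑ i, d i * (Y i ω ^ 2 - 1)|} ⊆
      {ω | ε * Fintype.card ι ≤ ∑ i, d i * (Y i ω ^ 2 - 1)} ∪
        {ω | ε * Fintype.card ι ≤ ∑ i, -d i * (Y i ω ^ 2 - 1)} := by
    intro ω hω
    rcases le_abs.1 (show ε * Fintype.card ι ≤ |∑ i, d i * (Y i ω ^ 2 - 1)| from hω) with h | h
    · exact Or.inl h
    · refine Or.inr ?_
      simpa [Finset.sum_neg_distrib] using h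
  refine (measureReal_mono hsub).trans ((measureReal_union_le _ _).trans ?_)
  linarith

open scoped Matrix.Norms.L2Operator in
/-- Exponential concentration of a quadratic form in a centered Gaussian vector. -/
theorem measure_le_abs_quadratic_sub_trace_le {ι : Type*} [Fintype ι] [DecidableEq ι]
    {X : ι → Ω → ℝ} (hX : HasGaussianLaw (fun ω i => X i ω) Pr) (hX0 : ∀ i, ∫ ω, X i ω ∂Pr = 0)
    {Cov : Matrix ι ι ℝ} (hcov : ∀ i j, cov[X i, X j; Pr] = Cov i j) (hpos : Cov.PosDef)
    {A : Matrix ι ι ℝ} (hA : A.IsHermitian) {D ε : ℝ} (hε : 0 < ε) (hεD : ε ≤ D)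
    (hD : ‖A‖ * ‖Cov‖ ≤ D) :
    Pr {ω | ε * Fintype.card ι ≤ |(fun i => X i ω) ⬝ᵥ A *ᵥ (fun i => X i ω) - (A * Cov).trace|} ≤
      ENNReal.ofReal (2 * Real.exp (-(ε ^ 2 / (16 * D ^ 2)) * Fintype.card ι)) := by
  -- Diagonalizing A relative to Cov⁻¹ gives Cov = R Rᵀ. Then Y = R⁻¹X is standard Gaussian, and
  -- XᵀAX becomes Σ d_k Y_k², with mean Σ d_k = tr(A Cov).
  obtain ⟨R, d, hR, h1, h2⟩ := hpos.inv.exists_simultaneous_diagonal hA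
  have hRt : IsUnit Rᵀ.det := by rwa [Matrix.det_transpose]
  have hCu : IsUnit Cov.det := hpos.det_pos.ne'.isUnit
  have hCov : Cov = R * Rᵀ := by
    have e1 : Rᵀ * (Cov⁻¹ * R) = 1 := by rw [← mul_assoc, h1]
    have e2 : Cov⁻¹ * R * Rᵀ = 1 := mul_eq_one_comm.1 e1
    calc Cov = Cov * (Cov⁻¹ * R * Rᵀ) := by rw [e2, mul_one]
      _ = Cov * Cov⁻¹ * (R * Rᵀ) := by simp only [mul_assoc]
      _ = R * Rᵀ := by rw [Matrix.mul_nonsing_inv _ hCu, one_mul]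
  have hd : ∀ i, |d i| ≤ D := fun i => by
    have e1 : d i = (R *ᵥ Pi.single i 1) ⬝ᵥ A *ᵥ (R *ᵥ Pi.single i 1) := by
      rw [Matrix.dotProduct_mulVec, Matrix.vecMul_mulVec, ← Matrix.dotProduct_mulVec,
        Matrix.mulVec_mulVec, h2]
      simp
    have e2 : (R *ᵥ Pi.single i 1) ⬝ᵥ (R *ᵥ Pi.single i 1) ≤ ‖Cov‖ := by
      have := Matrix.mulVec_dotProduct_mulVec_le R (Pi.single i 1)
      refine this.trans (le_of_eq ?_)
      -- The C*-identity gives ‖R‖² = ‖R Rᵀ‖ = ‖Cov‖, hence |d_i| ≤ ‖A‖ ‖Cov‖.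
      have hn := Matrix.l2_opNorm_conjTranspose_mul_self Rᵀ
      rw [Matrix.conjTranspose_eq_transpose_of_trivial, Matrix.transpose_transpose, ← hCov,
        Matrix.l2_opNorm_transpose] at hn
      rw [hn]
      simp [sq]
    rw [e1]
    refine (Matrix.abs_dotProduct_mulVec_le A _).trans (le_trans ?_ hD)
    gcongr
  let Y : ι → Ω → ℝ := fun k ω => ∑ i, R⁻¹ k i * X i ω
  have hYX : ∀ ω, (fun i => X i ω) = R *ᵥ (fun k => Y k ω) := fun ω => by
    have : (fun k => Y k ω) = R⁻¹ *ᵥ (fun i => X i ω) := rfl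
    rw [this, Matrix.mulVec_mulVec, Matrix.mul_nonsing_inv _ hR, Matrix.one_mulVec]
  have hXi : ∀ i, HasGaussianLaw (X i) Pr := fun i => hX.eval i
  have hX2 : ∀ i, MemLp (X i) 2 Pr := fun i => (hXi i).memLp_two
  have hYG : HasGaussianLaw (fun ω k => Y k ω) Pr :=
    hX.map_fun (LinearMap.toContinuousLinearMap (Matrix.mulVecLin R⁻¹))
  have hYi : ∀ k, HasGaussianLaw (Y k) Pr := fun k => hYG.eval k
  have hYcov : ∀ k l, cov[Y k, Y l; Pr] = (1 : Matrix ι ι ℝ) k l := fun k l => by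
    have e : cov[Y k, Y l; Pr] = (R⁻¹ * Cov * R⁻¹ᵀ) k l := by
      rw [covariance_fun_sum_fun_sum (fun i => (hX2 i).const_mul _) (fun i => (hX2 i).const_mul _)]
      simp only [covariance_const_mul_left, covariance_const_mul_right, hcov]
      simp only [Matrix.mul_apply, Finset.sum_mul, Matrix.transpose_apply]
      rw [Finset.sum_comm]
      refine Finset.sum_congr rfl fun j _ => Finset.sum_congr rfl fun i _ => by ring
    rw [e, hCov]
    have : R⁻¹ * (R * Rᵀ) * R⁻¹ᵀ = 1 := by
      rw [← mul_assoc, Matrix.nonsing_inv_mul _ hR, one_mul, Matrix.transpose_nonsing_inv,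
        Matrix.mul_nonsing_inv _ hRt]
    rw [this]
  have hY0 : ∀ k, ∫ ω, Y k ω ∂Pr = 0 := fun k => by
    rw [integral_finsetSum _ fun i _ => ((hX2 i).integrable (by norm_num)).const_mul _]
    simp [integral_const_mul, hX0]
  have hYm : ∀ k, AEMeasurable (Y k) Pr := fun k => (hYi k).aemeasurable
  have hYlaw : ∀ k, Pr.map (Y k) = gaussianReal 0 1 := fun k => by
    rw [(hYi k).map_eq_gaussianReal, hY0 k, ← covariance_self (hYm k), hYcov k k]
    simp
  have hind : iIndepFun Y Pr := hYG.iIndepFun_of_covariance_eq_zero fun k l hkl => by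
    rw [hYcov, Matrix.one_apply_ne hkl]
  have hquad : ∀ ω, (fun i => X i ω) ⬝ᵥ A *ᵥ (fun i => X i ω) - (A * Cov).trace =
      ∑ k, d k * (Y k ω ^ 2 - 1) := fun ω => by
    rw [hYX ω, Matrix.dotProduct_mulVec, Matrix.vecMul_mulVec, ← Matrix.dotProduct_mulVec,
      Matrix.mulVec_mulVec, h2, hCov, ← mul_assoc, Matrix.trace_mul_comm, ← mul_assoc, h2]
    simp only [Matrix.mulVec_diagonal, dotProduct, Matrix.trace_diagonal, ← Finset.sum_sub_distrib]
    exact Finset.sum_congr rfl fun k _ => by ring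
  simp only [hquad]
  exact measure_le_abs_sum_sq_sub_one_le hYm hYlaw hind hε hεD hd

open scoped Matrix.Norms.L2Operator in
open Classical in
/-- Strong law of large numbers for quadratic forms in a Gaussian process, along an increasing
sequence of finite index sets. -/
theorem ae_tendsto_quadratic_sub_trace {G : Type*} {V : ℕ → Finset G} (hV : Monotone V)
    (hcard : Tendsto (fun n => (V n).card) atTop atTop)
    {X : G → Ω → ℝ} (hX : IsGaussianProcess X Pr) (hX0 : ∀ i, ∫ ω, X i ω ∂Pr = 0)
    {Cov A : ∀ S : Finset G, Matrix S S ℝ}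
    (hcov : ∀ (S : Finset G) (i j : S), cov[X i, X j; Pr] = Cov S i j)
    (hpos : ∀ S, (Cov S).PosDef) (hA : ∀ n, (A (V n)).IsHermitian) {C C' : ℝ}
    (hC : ∀ n, ‖A (V n)‖ ≤ C) (hC' : ∀ S, ‖Cov S‖ ≤ C') :
    ∀ᵐ ω ∂Pr, Tendsto (fun n => ((fun i : V n => X i ω) ⬝ᵥ A (V n) *ᵥ (fun i : V n => X i ω) -
      (A (V n) * Cov (V n)).trace) / (V n).card) atTop (𝓝 0) := by
  set Q : Finset G → Ω → ℝ := fun S ω =>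
    (fun i : S => X i ω) ⬝ᵥ A S *ᵥ (fun i : S => X i ω) - (A S * Cov S).trace with hQ
  have key : ∀ ε : ℝ, 0 < ε → ∀ᵐ ω ∂Pr, ∀ᶠ n in atTop, |Q (V n) ω / (V n).card| ≤ ε := by
    intro ε hε
    set D : ℝ := max ε (C * C') with hDdef
    have hD0 : 0 < D := lt_max_of_lt_left hε
    -- Bad events are indexed by the cardinality m: the sets `V n` may stay constant for arbitrarily
    -- long, so bounds in terms of `V n` need not be summable in n. By monotonicity, m determines
    -- the set, so one probability bound serves all n with that cardinality.
    let s : ℕ → Set Ω := fun m => {ω | ∃ n, (V n).card = m ∧ ε * m ≤ |Q (V n) ω|}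
    have hs : ∀ m, Pr (s m) ≤
        ENNReal.ofReal (2 * Real.exp (-(ε ^ 2 / (16 * D ^ 2)) * m)) := fun m => by
      by_cases hm : ∃ n, (V n).card = m
      · obtain ⟨n, hn⟩ := hm
        have hsub : s m ⊆ {ω | ε * Fintype.card (V n) ≤ |Q (V n) ω|} := by
          rintro ω ⟨n', hn', hω⟩
          have : V n' = V n := by
            rcases le_total n n' with h | h
            · exact (Finset.eq_of_subset_of_card_le (hV h) (by omega)).symm
            · exact Finset.eq_of_subset_of_card_le (hV h) (by omega)
          rw [this] at hω
          simpa [hn] using hω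
        refine (measure_mono hsub).trans ?_
        have hb := measure_le_abs_quadratic_sub_trace_le (X := fun (i : V n) ω => X i ω)
          (hX.hasGaussianLaw (V n)) (fun i => hX0 i) (hcov (V n)) (hpos (V n)) (hA n) hε
          (le_max_left ε (C * C')) (le_trans ?_ (le_max_right ε (C * C')))
        · rw [Fintype.card_coe, hn] at hb
          simpa only [hQ, Fintype.card_coe, hn] using hb
        · exact mul_le_mul (hC _) (hC' _) (norm_nonneg _) ((norm_nonneg _).trans (hC n))
      · have : s m = ∅ := by
          ext ω
          simp only [s, Set.mem_ofPred_eq, Set.mem_empty_iff_false, iff_false]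
          rintro ⟨n, hn, -⟩
          exact hm ⟨n, hn⟩
        rw [this]
        simp
    have hsum : Summable fun m : ℕ => 2 * Real.exp (-(ε ^ 2 / (16 * D ^ 2)) * m) := by
      refine Summable.mul_left 2 ?_
      simp only [mul_comm _ (Nat.cast _ : ℝ)]
      refine Real.summable_exp_nat_mul_iff.2 ?_
      have : 0 < ε ^ 2 / (16 * D ^ 2) := by positivity
      linarith
    have hfin : ∑' m, Pr (s m) ≠ ⊤ :=
      ne_top_of_le_ne_top hsum.tsum_ofReal_ne_top (ENNReal.tsum_le_tsum hs)
    filter_upwards [ae_eventually_notMem hfin] with ω hω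
    filter_upwards [hcard.eventually hω, hcard.eventually_gt_atTop 0] with n hn h0
    have h0' : (0 : ℝ) < (V n).card := by exact_mod_cast h0
    rw [abs_div, abs_of_pos h0', div_le_iff₀ h0']
    by_contra! h
    exact hn ⟨n, rfl, h.le⟩
  have hall : ∀ᵐ ω ∂Pr, ∀ k : ℕ, ∀ᶠ n in atTop, |Q (V n) ω / (V n).card| ≤ 1 / ((k : ℝ) + 1) :=
    ae_all_iff.2 fun k => key _ (by positivity)
  filter_upwards [hall] with ω hω
  rw [Metric.tendsto_nhds]
  intro ε hε
  obtain ⟨k, hk⟩ := exists_nat_one_div_lt hε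
  filter_upwards [hω k] with n hn
  rw [Real.dist_eq, sub_zero]
  exact hn.trans_lt hk

end Gaussian

end

noncomputable section

/-! ### Convergence of minimizers -/

/-- Finitely many balls centered in the dense set D cover Θ; an ε/3 argument transfers convergence
from their centers. -/
theorem eventually_forall_abs_sub_le_of_equicontinuous {F : ℕ → ℝ → ℝ} {l : ℝ → ℝ} {Θ D : Set ℝ}
    (hΘ : IsCompact Θ) (hDΘ : D ⊆ Θ) (hD : Θ ⊆ closure D)
    (hpt : ∀ θ ∈ D, Tendsto (fun n => F n θ) atTop (𝓝 (l θ)))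
    (hF : ∀ ε > 0, ∃ δ > 0, ∀ᶠ n in atTop, ∀ θ ∈ Θ, ∀ θ' ∈ Θ, |θ - θ'| < δ →
      |F n θ - F n θ'| ≤ ε)
    (hl : ∀ ε > 0, ∃ δ > 0, ∀ θ ∈ Θ, ∀ θ' ∈ Θ, |θ - θ'| < δ → |l θ - l θ'| ≤ ε)
    {ε : ℝ} (hε : 0 < ε) : ∀ᶠ n in atTop, ∀ θ ∈ Θ, |F n θ - l θ| ≤ ε := by
  obtain ⟨δ₁, hδ₁, h₁⟩ := hF (ε / 3) (by positivity)
  obtain ⟨δ₂, hδ₂, h₂⟩ := hl (ε / 3) (by positivity)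
  set δ := min δ₁ δ₂ with hδ
  have hδ0 : 0 < δ := lt_min hδ₁ hδ₂
  obtain ⟨t, htD, htf, ht⟩ := hΘ.elim_finite_subcover_image (b := D)
    (c := fun d => Metric.ball d δ) (fun _ _ => Metric.isOpen_ball) fun θ hθ => by
      obtain ⟨d, hd, hdist⟩ := Metric.mem_closure_iff.1 (hD hθ) δ hδ0
      exact Set.mem_biUnion hd hdist
  have h₃ : ∀ᶠ n in atTop, ∀ d ∈ t, |F n d - l d| ≤ ε / 3 :=
    (eventually_all_finite htf).2 fun d hd => by
      filter_upwards [Metric.tendsto_nhds.1 (hpt d (htD hd)) (ε / 3) (by positivity)] with n hn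
      exact hn.le
  filter_upwards [h₁, h₃] with n hn₁ hn₃ θ hθ
  obtain ⟨d, hd, hdist⟩ := Set.mem_iUnion₂.1 (ht hθ)
  have hdist' : |θ - d| < δ := hdist
  have e1 := hn₁ θ hθ d (hDΘ (htD hd)) (hdist'.trans_le (min_le_left _ _))
  have e2 := h₂ θ hθ d (hDΘ (htD hd)) (hdist'.trans_le (min_le_right _ _))
  have e3 := hn₃ d hd
  rw [abs_le] at *
  constructor <;> linarith [e1.1, e1.2, e2.1, e2.2, e3.1, e3.2]

/-- Away from θ₀ the limit exceeds its minimum by a fixed gap, by compactness; once the uniform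
error is below a third of the gap, no point there can do as well as θ₀. -/
theorem tendsto_of_approximate_minimizers {F : ℕ → ℝ → ℝ} {l : ℝ → ℝ} {Θ : Set ℝ}
    (hΘ : IsCompact Θ) {θ₀ : ℝ} (hθ₀ : θ₀ ∈ Θ) (hl : ContinuousOn l Θ)
    (hmin : ∀ θ ∈ Θ, θ ≠ θ₀ → l θ₀ < l θ)
    (hF : ∀ ε > 0, ∀ᶠ n in atTop, ∀ θ ∈ Θ, |F n θ - l θ| ≤ ε) {θhat : ℕ → ℝ}
    (hhat : ∀ᶠ n in atTop, θhat n ∈ Θ ∧ F n (θhat n) ≤ F n θ₀) :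
    Tendsto θhat atTop (𝓝 θ₀) := by
  rw [Metric.tendsto_nhds]
  intro δ hδ
  have hK : IsCompact (Θ \ Metric.ball θ₀ δ) := hΘ.diff Metric.isOpen_ball
  rcases (Θ \ Metric.ball θ₀ δ).eq_empty_or_nonempty with h0 | h0
  · filter_upwards [hhat] with n hn
    by_contra h
    have : θhat n ∈ Θ \ Metric.ball θ₀ δ := ⟨hn.1, h⟩
    rw [h0] at this
    exact this
  · obtain ⟨θ₁, hθ₁, hθ₁min⟩ := hK.exists_isMinOn h0 (hl.mono Set.sdiff_subset)
    have hne : θ₁ ≠ θ₀ := by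
      rintro rfl
      exact hθ₁.2 (Metric.mem_ball_self hδ)
    have hgap := hmin θ₁ hθ₁.1 hne
    filter_upwards [hhat, hF ((l θ₁ - l θ₀) / 3) (by linarith)] with n hn hFn
    by_contra h
    have h1 : l θ₁ ≤ l (θhat n) := hθ₁min (show θhat n ∈ Θ \ Metric.ball θ₀ δ from ⟨hn.1, h⟩)
    have h2 := abs_le.1 (hFn _ hn.1)
    have h3 := abs_le.1 (hFn _ hθ₀)
    linarith [hn.2, h2.1, h3.2]

namespace WeightedGraph

open scoped Matrix.Norms.L2Operator
open Classical

variable {G : Type*} (Γ : WeightedGraph G)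

/-! ### Regularity of the spectral densities -/

/-- The logarithms of two spectral densities are uniformly close on the spectrum. -/
def LogClose (η : ℝ) (g h : ℝ → ℝ) : Prop :=
  ∀ x ∈ Γ.Sp, |Real.log (g x) - Real.log (h x)| ≤ η

theorem Sp_subset_hull : Γ.Sp ⊆ Γ.hull := subset_convexHull ℝ _

theorem abs_le_one_of_mem_Sp {x : ℝ} (hx : x ∈ Γ.Sp) : |x| ≤ 1 :=
  _root_.abs_le.2 (Γ.Sp_subset_Icc hx)

/-- The factor k + 1, where k would do, matches the weight in α(log f), so that ρ itself is a
Lipschitz constant of log f on the spectrum. -/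
theorem abs_pow_sub_pow_le_mul {x y : ℝ} (hx : |x| ≤ 1) (hy : |y| ≤ 1) (k : ℕ) :
    |x ^ k - y ^ k| ≤ ((k : ℝ) + 1) * |x - y| := by
  induction k with
  | zero => simp
  | succ k ih =>
    have e : x ^ (k + 1) - y ^ (k + 1) = x * (x ^ k - y ^ k) + (x - y) * y ^ k := by ring
    have h1 : |y ^ k| ≤ 1 := by rw [abs_pow]; exact pow_le_one₀ (abs_nonneg _) hy
    rw [e]
    refine (abs_add_le _ _).trans ?_
    rw [abs_mul, abs_mul]
    have h2 : |x| * |x ^ k - y ^ k| ≤ 1 * (((k : ℝ) + 1) * |x - y|) :=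
      mul_le_mul hx ih (abs_nonneg _) zero_le_one
    have h3 : |x - y| * |y ^ k| ≤ |x - y| * 1 := by gcongr
    push_cast
    linarith

section MemFρ

variable {Γ} {ρ : ℝ} {f : ℝ → ℝ}

theorem MemFρ.continuousOn (hf : Γ.MemFρ ρ f) : ContinuousOn f Γ.Sp :=
  hf.analytic.continuousOn.mono Γ.Sp_subset_hull

theorem MemFρ.pos_of_mem_Sp (hf : Γ.MemFρ ρ f) {x : ℝ} (hx : x ∈ Γ.Sp) : 0 < f x :=
  hf.pos x (Γ.Sp_subset_hull hx)

theorem MemFρ.abs_log_le (hf : Γ.MemFρ ρ f) {x : ℝ} (hx : x ∈ Γ.Sp) : |Real.log (f x)| ≤ ρ := by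
  obtain ⟨c, hc, hs, hle⟩ := hf.regular
  have hb : ∀ k, ‖c k * x ^ k‖ ≤ |c k| * ((k : ℝ) + 1) := fun k => by
    rw [Real.norm_eq_abs, abs_mul, abs_pow]
    gcongr
    calc |x| ^ k ≤ 1 := pow_le_one₀ (abs_nonneg _) (Γ.abs_le_one_of_mem_Sp hx)
      _ ≤ (k : ℝ) + 1 := by linarith [(Nat.cast_nonneg k : (0 : ℝ) ≤ k)]
  rw [← (hc x (Γ.Sp_subset_hull hx)).tsum_eq]
  exact (tsum_of_norm_bounded hs.hasSum hb).trans hle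

theorem MemFρ.abs_log_sub_log_le (hf : Γ.MemFρ ρ f) {x y : ℝ} (hx : x ∈ Γ.Sp) (hy : y ∈ Γ.Sp) :
    |Real.log (f x) - Real.log (f y)| ≤ ρ * |x - y| := by
  obtain ⟨c, hc, hs, hle⟩ := hf.regular
  have hb : ∀ k, ‖c k * x ^ k - c k * y ^ k‖ ≤ |c k| * ((k : ℝ) + 1) * |x - y| := fun k => by
    rw [Real.norm_eq_abs, ← mul_sub, abs_mul, mul_assoc]
    gcongr
    exact abs_pow_sub_pow_le_mul (Γ.abs_le_one_of_mem_Sp hx) (Γ.abs_le_one_of_mem_Sp hy) k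
  rw [← ((hc x (Γ.Sp_subset_hull hx)).sub (hc y (Γ.Sp_subset_hull hy))).tsum_eq]
  refine (tsum_of_norm_bounded (hs.hasSum.mul_right _) hb).trans ?_
  gcongr

theorem MemFρ.exp_neg_le (hf : Γ.MemFρ ρ f) {x : ℝ} (hx : x ∈ Γ.Sp) : Real.exp (-ρ) ≤ f x := by
  rw [← Real.le_log_iff_exp_le (hf.pos_of_mem_Sp hx)]
  exact (_root_.abs_le.1 (hf.abs_log_le hx)).1

theorem MemFρ.le_exp (hf : Γ.MemFρ ρ f) {x : ℝ} (hx : x ∈ Γ.Sp) : f x ≤ Real.exp ρ := by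
  rw [← Real.log_le_iff_le_exp (hf.pos_of_mem_Sp hx)]
  exact (_root_.abs_le.1 (hf.abs_log_le hx)).2

theorem MemFρ.abs_le_exp (hf : Γ.MemFρ ρ f) {x : ℝ} (hx : x ∈ Γ.Sp) : |f x| ≤ Real.exp ρ := by
  rw [abs_of_pos (hf.pos_of_mem_Sp hx)]
  exact hf.le_exp hx

theorem MemFρ.continuousOn_inv (hf : Γ.MemFρ ρ f) : ContinuousOn (fun x => 1 / f x) Γ.Sp :=
  continuousOn_const.div hf.continuousOn fun _ hx => (hf.pos_of_mem_Sp hx).ne'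

theorem MemFρ.continuousOn_log (hf : Γ.MemFρ ρ f) : ContinuousOn (fun x => Real.log (f x)) Γ.Sp :=
  hf.continuousOn.log fun _ hx => (hf.pos_of_mem_Sp hx).ne'

theorem MemFρ.abs_inv_le_exp (hf : Γ.MemFρ ρ f) {x : ℝ} (hx : x ∈ Γ.Sp) :
    |1 / f x| ≤ Real.exp ρ := by
  have h := hf.pos_of_mem_Sp hx
  rw [abs_of_pos (by positivity), one_div, ← Real.exp_log h, ← Real.exp_neg]
  gcongr
  linarith [(_root_.abs_le.1 (hf.abs_log_le hx)).1]

theorem abs_exp_sub_exp_le {s t r : ℝ} (hs : s ≤ r) (ht : t ≤ r) :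
    |Real.exp s - Real.exp t| ≤ Real.exp r * |s - t| := by
  have key : ∀ {s t : ℝ}, s ≤ r → t ≤ s → |Real.exp s - Real.exp t| ≤ Real.exp r * |s - t| := by
    intro s t hs hts
    rw [abs_of_nonneg (sub_nonneg.2 (Real.exp_le_exp.2 hts)), abs_of_nonneg (sub_nonneg.2 hts)]
    have h1 : 1 - Real.exp (t - s) ≤ s - t := by linarith [Real.add_one_le_exp (t - s)]
    have h2 : Real.exp s - Real.exp t = Real.exp s * (1 - Real.exp (t - s)) := by
      rw [mul_sub, ← Real.exp_add]; ring_nf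
    rw [h2]
    calc _ ≤ Real.exp s * (s - t) := by gcongr
      _ ≤ _ := by
        have := sub_nonneg.2 hts
        gcongr
  rcases le_total t s with h | h
  · exact key hs h
  · rw [abs_sub_comm, abs_sub_comm s t]
    exact key ht h

variable {g : ℝ → ℝ} {η : ℝ}

theorem LogClose.abs_sub_le (hfg : Γ.LogClose η f g) (hf : Γ.MemFρ ρ f) (hg : Γ.MemFρ ρ g)
    {x : ℝ} (hx : x ∈ Γ.Sp) : |f x - g x| ≤ Real.exp ρ * η := by
  rw [← Real.exp_log (hf.pos_of_mem_Sp hx), ← Real.exp_log (hg.pos_of_mem_Sp hx)]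
  refine (abs_exp_sub_exp_le (_root_.abs_le.1 (hf.abs_log_le hx)).2
    (_root_.abs_le.1 (hg.abs_log_le hx)).2).trans ?_
  gcongr
  exact hfg x hx

theorem LogClose.abs_inv_sub_inv_le (hfg : Γ.LogClose η f g) (hf : Γ.MemFρ ρ f)
    (hg : Γ.MemFρ ρ g) {x : ℝ} (hx : x ∈ Γ.Sp) : |1 / f x - 1 / g x| ≤ Real.exp ρ * η := by
  have e : ∀ {h : ℝ → ℝ}, Γ.MemFρ ρ h → 1 / h x = Real.exp (-Real.log (h x)) := fun hh => by
    rw [Real.exp_neg, Real.exp_log (hh.pos_of_mem_Sp hx), one_div]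
  rw [e hf, e hg]
  refine (abs_exp_sub_exp_le (r := ρ) (by linarith [(_root_.abs_le.1 (hf.abs_log_le hx)).1])
    (by linarith [(_root_.abs_le.1 (hg.abs_log_le hx)).1])).trans ?_
  gcongr
  rw [neg_sub_neg, abs_sub_comm]
  exact hfg x hx

end MemFρ

/-- Continuity in θ at each x, together with a Lipschitz constant in x independent of θ, gives joint
continuity on the compact Sp(W) × Θ, hence uniform continuity. -/
theorem exists_delta_logClose {Θ : Set ℝ} (hΘ : IsCompact Θ) {ρ : ℝ} {f : ℝ → ℝ → ℝ}
    (hcont : ∀ x ∈ Γ.Sp, ContinuousOn (fun θ => f θ x) Θ) (hreg : ∀ θ ∈ Θ, Γ.MemFρ ρ (f θ))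
    {η : ℝ} (hη : 0 < η) :
    ∃ δ > 0, ∀ θ ∈ Θ, ∀ θ' ∈ Θ, |θ - θ'| < δ → Γ.LogClose η (f θ) (f θ') := by
  have hjoint : ContinuousOn (fun p : ℝ × ℝ => Real.log (f p.2 p.1)) (Γ.Sp ×ˢ Θ) := by
    refine continuousOn_prod_of_continuousOn_lipschitzOnWith _ ρ.toNNReal (fun x hx => ?_)
      fun θ hθ => ?_
    · exact (hcont x hx).log fun θ hθ => ((hreg θ hθ).pos_of_mem_Sp hx).ne'
    · refine LipschitzOnWith.of_dist_le_mul fun x hx y hy => ?_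
      rw [Real.dist_eq, Real.dist_eq]
      refine ((hreg θ hθ).abs_log_sub_log_le hx hy).trans ?_
      gcongr
      exact Real.le_coe_toNNReal ρ
  have hu := (Γ.isCompact_Sp.prod hΘ).uniformContinuousOn_of_continuous hjoint
  obtain ⟨δ, hδ, h⟩ := Metric.uniformContinuousOn_iff.1 hu η hη
  refine ⟨δ, hδ, fun θ hθ θ' hθ' hd x hx => ?_⟩
  have := h (x, θ) ⟨hx, hθ⟩ (x, θ') ⟨hx, hθ'⟩ (by
    rw [Prod.dist_eq]
    simpa [hδ, Real.dist_eq] using hd)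
  exact this.le

/-! ### The contrast -/

section Contrast

variable {Γ} {V : ℕ → Finset G} {μ : FiniteMeasure ℝ} {ρ : ℝ} {f g : ℝ → ℝ}

/-- On the spectrum the difference of the integrands is t - 1 - log t with t = f/g, which is
nonnegative and vanishes only at t = 1. -/
theorem contrast_lt (hμ : Tendsto (fun n => Γ.avgMeasure (V n)) atTop (𝓝 μ))
    (hf : Γ.MemFρ ρ f) (hg : Γ.MemFρ ρ g) (hne : ¬ g =ᵐ[(μ : Measure ℝ)] f) :
    ∫ x, Real.log (f x) ∂(μ : Measure ℝ) + ∫ x, 1 / f x * f x ∂(μ : Measure ℝ) <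
      ∫ x, Real.log (g x) ∂(μ : Measure ℝ) + ∫ x, 1 / g x * f x ∂(μ : Measure ℝ) := by
  have hi1 := integrable_of_continuousOn_Sp hμ hf.continuousOn_log
  have hi2 : Integrable (fun x => 1 / f x * f x) (μ : Measure ℝ) :=
    integrable_of_continuousOn_Sp hμ (hf.continuousOn_inv.mul hf.continuousOn)
  have hi3 := integrable_of_continuousOn_Sp hμ hg.continuousOn_log
  have hi4 : Integrable (fun x => 1 / g x * f x) (μ : Measure ℝ) :=
    integrable_of_continuousOn_Sp hμ (hg.continuousOn_inv.mul hf.continuousOn)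
  have hi12 : Integrable (fun x => Real.log (f x) + 1 / f x * f x) (μ : Measure ℝ) := hi1.add hi2
  have hi34 : Integrable (fun x => Real.log (g x) + 1 / g x * f x) (μ : Measure ℝ) := hi3.add hi4
  rw [← sub_pos, ← integral_add hi1 hi2, ← integral_add hi3 hi4, ← integral_sub hi34 hi12]
  have hval : ∀ x ∈ Γ.Sp, Real.log (g x) + 1 / g x * f x - (Real.log (f x) + 1 / f x * f x) =
      f x / g x - 1 - Real.log (f x / g x) := fun x hx => by
    have h1 := (hf.pos_of_mem_Sp hx).ne'
    have h2 := (hg.pos_of_mem_Sp hx).ne'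
    rw [Real.log_div h1 h2, one_div_mul_cancel h1]
    ring
  have hnonneg : 0 ≤ᵐ[(μ : Measure ℝ)] fun x =>
      Real.log (g x) + 1 / g x * f x - (Real.log (f x) + 1 / f x * f x) := by
    filter_upwards [ae_mem_Sp hμ] with x hx
    rw [hval x hx]
    have := Real.log_le_sub_one_of_pos (div_pos (hf.pos_of_mem_Sp hx) (hg.pos_of_mem_Sp hx))
    simpa using this
  refine lt_of_le_of_ne (integral_nonneg_of_ae hnonneg) fun h0 => hne ?_
  have hz := (integral_eq_zero_iff_of_nonneg_ae hnonneg (hi34.sub hi12)).1 h0.symm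
  filter_upwards [ae_mem_Sp hμ, hz] with x hx hzx
  have hzx' : Real.log (g x) + 1 / g x * f x - (Real.log (f x) + 1 / f x * f x) = 0 := hzx
  rw [hval x hx] at hzx'
  have hp := div_pos (hf.pos_of_mem_Sp hx) (hg.pos_of_mem_Sp hx)
  have h1 : f x / g x = 1 := by
    by_contra hne1
    linarith [Real.log_lt_sub_one_of_pos hp hne1]
  exact ((div_eq_one_iff_eq (hg.pos_of_mem_Sp hx).ne').1 h1).symm

end Contrast

end WeightedGraph

end

noncomputable section

namespace WeightedGraph

open scoped Matrix.Norms.L2Operator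
open Classical

/-! ### Consistency of quasi-likelihood estimators -/

section Consistency

variable {G : Type*} {Γ : WeightedGraph G} {V : ℕ → Finset G} {Θ : Set ℝ} {f : ℝ → ℝ → ℝ} {θ₀ : ℝ}
  {Ω : Type*} [MeasurableSpace Ω] {Pr : Measure Ω} [IsProbabilityMeasure Pr] {X : G → Ω → ℝ}

/-- A quasi-likelihood whose normalized logarithmic and quadratic parts converge to a contrast with
a unique minimum gives consistent estimators. -/
theorem maximizersConverge_of_quadratic (hV : Monotone V)
    (hcard : Tendsto (fun n => (V n).card) atTop atTop) (hΘ : IsCompact Θ) (hθ₀ : θ₀ ∈ Θ)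
    (hclose : ∀ η > 0, ∃ δ > 0, ∀ θ ∈ Θ, ∀ θ' ∈ Θ, |θ - θ'| < δ → Γ.LogClose η (f θ) (f θ'))
    (hX : IsGaussianProcess X Pr) (hX0 : ∀ i, ∫ ω, X i ω ∂Pr = 0)
    {Cov : ∀ S : Finset G, Matrix S S ℝ}
    (hcov : ∀ (S : Finset G) (i j : S), cov[X i, X j; Pr] = Cov S i j)
    (hpos : ∀ S, (Cov S).PosDef) {C' : ℝ} (hC' : ∀ S, ‖Cov S‖ ≤ C')
    {D : Finset G → ℝ → ℝ} {A : ∀ S : Finset G, ℝ → Matrix S S ℝ} {d e : ℝ → ℝ} {C κ : ℝ}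
    (hκ : 0 < κ)
    (hD : ∀ n, ∀ θ ∈ Θ, ∀ θ' ∈ Θ, ∀ η > 0, Γ.LogClose η (f θ) (f θ') →
      |D (V n) θ - D (V n) θ'| ≤ (V n).card * (κ * η))
    (hA : ∀ n, ∀ θ ∈ Θ, ∀ θ' ∈ Θ, ∀ η > 0, Γ.LogClose η (f θ) (f θ') →
      ‖A (V n) θ - A (V n) θ'‖ ≤ κ * η)
    (hAsymm : ∀ n, ∀ θ ∈ Θ, (A (V n) θ).IsHermitian) (hAC : ∀ n, ∀ θ ∈ Θ, ‖A (V n) θ‖ ≤ C)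
    (hd : ∀ θ ∈ Θ, Tendsto (fun n => D (V n) θ / (V n).card) atTop (𝓝 (d θ)))
    (he : ∀ θ ∈ Θ, Tendsto (fun n => (A (V n) θ * Cov (V n)).trace / (V n).card) atTop (𝓝 (e θ)))
    (hmin : ∀ θ ∈ Θ, θ ≠ θ₀ → d θ₀ + e θ₀ < d θ + e θ) :
    MaximizersConverge Pr Θ θ₀ fun n θ ω =>
      -(1 / 2) * ((V n).card * Real.log (2 * Real.pi) + D (V n) θ +
        (fun i : V n => X i ω) ⬝ᵥ (A (V n) θ *ᵥ fun i : V n => X i ω)) := by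
  have hC'0 : 0 ≤ C' := (norm_nonneg _).trans (hC' ∅)
  set q : ℕ → ℝ → Ω → ℝ := fun n θ ω =>
    (fun i : V n => X i ω) ⬝ᵥ (A (V n) θ *ᵥ fun i : V n => X i ω) with hq
  -- The squared norm of the observations bounds the variation of the quadratic form in θ, so a
  -- single law of large numbers for it gives equicontinuity.
  set r : ℕ → Ω → ℝ := fun n ω => (fun i : V n => X i ω) ⬝ᵥ (fun i : V n => X i ω) with hr
  have hr0 : ∀ n ω, 0 ≤ r n ω := fun n ω => by
    simp only [hr]
    rw [Matrix.dotProduct_self_eq_norm_sq]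
    positivity
  have hqdiff : ∀ n, ∀ θ ∈ Θ, ∀ θ' ∈ Θ, ∀ η > 0, Γ.LogClose η (f θ) (f θ') → ∀ ω,
      |(D (V n) θ + q n θ ω) - (D (V n) θ' + q n θ' ω)| ≤ κ * η * ((V n).card + r n ω) := by
    intro n θ hθ θ' hθ' η hη hc ω
    have h1 := hD n θ hθ θ' hθ' η hη hc
    have h2 := (Matrix.abs_dotProduct_mulVec_le (A (V n) θ - A (V n) θ')
      (fun i : V n => X i ω)).trans
      (mul_le_mul_of_nonneg_right (hA n θ hθ θ' hθ' η hη hc) (hr0 n ω))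
    rw [Matrix.sub_mulVec, dotProduct_sub] at h2
    calc _ = |(D (V n) θ - D (V n) θ') + (q n θ ω - q n θ' ω)| := by ring_nf
      _ ≤ (V n).card * (κ * η) + κ * η * r n ω := (abs_add_le _ _).trans (add_le_add h1 h2)
      _ = _ := by ring
  refine ⟨fun n ω => ?_, fun θhat hhat => ?_⟩
  · have hcontq : ContinuousOn (fun θ => D (V n) θ + q n θ ω) Θ := by
      rw [Metric.continuousOn_iff]
      intro θ' hθ' ε hε
      have hp : 0 < κ * ((V n).card + r n ω + 1) := by
        have := hr0 n ω
        positivity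
      -- The added 1 keeps the denominator positive when both the cardinality and the squared norm
      -- vanish.
      obtain ⟨δ, hδ, h⟩ := hclose (ε / (2 * (κ * ((V n).card + r n ω + 1)))) (by positivity)
      refine ⟨δ, hδ, fun θ hθ hdist => ?_⟩
      have := hqdiff n θ hθ θ' hθ' _ (by positivity) (h θ hθ θ' hθ' hdist) ω
      rw [Real.dist_eq]
      refine this.trans_lt ?_
      have hr1 := hr0 n ω
      calc κ * (ε / (2 * (κ * ((V n).card + r n ω + 1)))) * ((V n).card + r n ω)
          ≤ κ * (ε / (2 * (κ * ((V n).card + r n ω + 1)))) * ((V n).card + r n ω + 1) :=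
            mul_le_mul_of_nonneg_left (by linarith) (by positivity)
        _ = ε / 2 := by field_simp
        _ < ε := by linarith
    obtain ⟨θ, hθ, hmx⟩ := hΘ.exists_isMinOn ⟨θ₀, hθ₀⟩ hcontq
    refine ⟨θ, hθ, fun θ' hθ' => ?_⟩
    have := hmx hθ'
    simp only [Set.mem_ofPred_eq] at this ⊢
    simp only [hq] at this
    linarith
  -- The exceptional null set of the strong law depends on θ; only countably many parameters may be
  -- used simultaneously.
  · obtain ⟨T, hTΘ, hTc, hT⟩ :=
      (TopologicalSpace.IsSeparable.of_separableSpace Θ).exists_countable_dense_subset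
    have hlaw : ∀ᵐ ω ∂Pr, ∀ θ ∈ T, Tendsto (fun n => (q n θ ω -
        (A (V n) θ * Cov (V n)).trace) / (V n).card) atTop (𝓝 0) :=
      (ae_ball_iff hTc).2 fun θ hθ =>
        ae_tendsto_quadratic_sub_trace hV hcard hX hX0 (A := fun S => A S θ) hcov hpos
          (fun n => hAsymm n θ (hTΘ hθ)) (fun n => hAC n θ (hTΘ hθ)) hC'
    have hnorm : ∀ᵐ ω ∂Pr, Tendsto (fun n => (r n ω - (Cov (V n)).trace) / (V n).card)
        atTop (𝓝 0) := by
      have h := ae_tendsto_quadratic_sub_trace hV hcard hX hX0 (A := fun S => 1) hcov hpos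
        (fun n => Matrix.isHermitian_one) (C := 1) (fun n => ?_) hC'
      · simpa only [Matrix.one_mulVec, one_mul] using h
      · exact Matrix.l2_opNorm_le_of_forall zero_le_one fun x => by simp
    filter_upwards [hlaw, hnorm, ae_all_iff.2 hhat] with ω hω hrω hhatω
    have hcard0 := hcard.eventually_gt_atTop 0
    have hrb : ∀ᶠ n in atTop, r n ω ≤ (C' + 1) * (V n).card := by
      filter_upwards [Metric.tendsto_nhds.1 hrω 1 one_pos, hcard0] with n hn h0
      have h0' : (0 : ℝ) < (V n).card := by exact_mod_cast h0
      rw [Real.dist_eq, sub_zero, abs_div, abs_of_pos h0', div_lt_iff₀ h0'] at hn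
      have h1 := (le_abs_self _).trans (Cov (V n)).abs_trace_le_card_mul_norm
      rw [Fintype.card_coe] at h1
      have h2 := mul_le_mul_of_nonneg_left (hC' (V n)) h0'.le
      linarith [le_abs_self (r n ω - (Cov (V n)).trace)]
    have hlcont : ∀ ε > 0, ∃ δ > 0, ∀ θ ∈ Θ, ∀ θ' ∈ Θ, |θ - θ'| < δ →
        |(d θ + e θ) - (d θ' + e θ')| ≤ ε := by
      intro ε hε
      obtain ⟨δ, hδ, h⟩ := hclose (ε / (κ * (1 + C'))) (by positivity)
      refine ⟨δ, hδ, fun θ hθ θ' hθ' hdist => ?_⟩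
      have hc := h θ hθ θ' hθ' hdist
      have hη : 0 < ε / (κ * (1 + C')) := by positivity
      -- The limiting contrast inherits its modulus of continuity from the finite-n estimates, so no
      -- regularity of d and e is needed.
      have hlim := (((hd θ hθ).add (he θ hθ)).sub ((hd θ' hθ').add (he θ' hθ'))).abs
      refine le_of_tendsto hlim ?_
      filter_upwards [hcard0] with n h0
      have h0' : (0 : ℝ) < (V n).card := by exact_mod_cast h0
      have h1 := hD n θ hθ θ' hθ' _ hη hc
      have h2 := (Matrix.abs_trace_le_card_mul_norm ((A (V n) θ - A (V n) θ') * Cov (V n))).trans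
        (mul_le_mul_of_nonneg_left ((norm_mul_le _ _).trans
          (mul_le_mul (hA n θ hθ θ' hθ' _ hη hc) (hC' (V n)) (norm_nonneg _) (by positivity)))
          (Nat.cast_nonneg _))
      rw [Fintype.card_coe, sub_mul, Matrix.trace_sub] at h2
      rw [← add_div, ← add_div, ← sub_div, abs_div, abs_of_pos h0', div_le_iff₀ h0']
      calc _ = |(D (V n) θ - D (V n) θ') + ((A (V n) θ * Cov (V n)).trace -
            (A (V n) θ' * Cov (V n)).trace)| := by ring_nf
        _ ≤ _ := (abs_add_le _ _).trans (add_le_add h1 h2)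
        _ = ε * (V n).card := by field_simp
    have hunif := fun (ε : ℝ) (hε : ε > 0) => eventually_forall_abs_sub_le_of_equicontinuous
      (F := fun n θ => (D (V n) θ + q n θ ω) / (V n).card) (l := fun θ => d θ + e θ)
      hΘ hTΘ hT (fun θ hθ => ?_) (fun ε hε => ?_) hlcont hε
    · refine tendsto_of_approximate_minimizers hΘ hθ₀ ?_ hmin hunif ?_
      · rw [Metric.continuousOn_iff]
        intro θ' hθ' ε hε
        obtain ⟨δ, hδ, h⟩ := hlcont (ε / 2) (by positivity)
        exact ⟨δ, hδ, fun θ hθ hdist => (h θ hθ θ' hθ' hdist).trans_lt (by linarith)⟩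
      · refine Eventually.of_forall fun n => ⟨(hhatω n).1, ?_⟩
        have := (hhatω n).2 hθ₀
        simp only [Set.mem_ofPred_eq] at this
        simp only [hq]
        gcongr ?_ / _
        linarith
    · have h1 := ((hω θ hθ).add (he θ (hTΘ hθ))).add (hd θ (hTΘ hθ))
      rw [zero_add, add_comm] at h1
      refine h1.congr fun n => ?_
      ring
    -- The constant C' + 2 collects 1 from the logarithmic part and C' + 1 from the bound on the
    -- squared norm of the observations.
    · obtain ⟨δ, hδ, h⟩ := hclose (ε / (κ * (C' + 2))) (by positivity)
      refine ⟨δ, hδ, ?_⟩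
      filter_upwards [hrb, hcard0] with n hn h0 θ hθ θ' hθ' hdist
      have h0' : (0 : ℝ) < (V n).card := by exact_mod_cast h0
      rw [← sub_div, abs_div, abs_of_pos h0', div_le_iff₀ h0']
      refine (hqdiff n θ hθ θ' hθ' _ (by positivity) (h θ hθ θ' hθ' hdist) ω).trans ?_
      calc _ ≤ κ * (ε / (κ * (C' + 2))) * ((V n).card + (C' + 1) * (V n).card) := by gcongr
        _ = ε * (V n).card := by field_simp; ring

end Consistency

end WeightedGraph

end

noncomputable section

/-! ### The boundary correction -/

open scoped Matrix.Norms.L2Operator in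
/-- Schur's test. -/
theorem Matrix.l2_opNorm_le_of_sum_abs_le {n : Type*} [Fintype n] [DecidableEq n]
    {M : Matrix n n ℝ} {r : ℝ} (hr : 0 ≤ r) (hrow : ∀ i, ∑ j, |M i j| ≤ r)
    (hcol : ∀ j, ∑ i, |M i j| ≤ r) : ‖M‖ ≤ r := by
  refine l2_opNorm_le_of_forall hr fun x => ?_
  calc (M *ᵥ x) ⬝ᵥ (M *ᵥ x) = ∑ i, (∑ j, M i j * x j) ^ 2 := by
        simp [dotProduct, mulVec, sq]
    _ ≤ ∑ i, (∑ j, |M i j|) * ∑ j, |M i j| * x j ^ 2 := by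
        refine Finset.sum_le_sum fun i _ => ?_
        refine Finset.sum_sq_le_sum_mul_sum_of_sq_le_mul _ (fun j _ => abs_nonneg _)
          (fun j _ => by positivity) fun j _ => le_of_eq ?_
        rw [mul_pow, ← sq_abs (M i j)]
        ring
    _ ≤ ∑ i, r * ∑ j, |M i j| * x j ^ 2 := by
        refine Finset.sum_le_sum fun i _ => mul_le_mul_of_nonneg_right (hrow i) ?_
        exact Finset.sum_nonneg fun j _ => by positivity
    _ = r * ∑ j, (∑ i, |M i j|) * x j ^ 2 := by
        rw [← Finset.mul_sum, Finset.sum_comm]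
        simp only [Finset.sum_mul]
    _ ≤ r * ∑ j, r * x j ^ 2 := by
        gcongr with j
        exact hcol j
    _ = r ^ 2 * (x ⬝ᵥ x) := by
        rw [← Finset.mul_sum, dotProduct]
        simp only [← sq]
        ring

/-- The functional is quadratic in v. This makes the polarized `pairMeasure` symmetric in its two
vertices, and therefore `B` and `Qmat` symmetric. -/
theorem spectralMeasure_neg {H : Type*} [NormedAddCommGroup H] [InnerProductSpace ℂ H]
    [CompleteSpace H] (A : H →L[ℂ] H) (hA : IsSelfAdjoint A) (v : H) :
    spectralMeasure A hA (-v) = spectralMeasure A hA v := by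
  have : spectralFunctional A hA (-v) = spectralFunctional A hA v := by
    ext g
    change (inner ℂ (-v) (cfcHom (R := ℝ) hA g.toContinuousMap (-v))).re =
      (inner ℂ v (cfcHom (R := ℝ) hA g.toContinuousMap v)).re
    rw [map_neg, inner_neg_neg]
  rw [spectralMeasure, spectralMeasure, this]

namespace WeightedGraph

open scoped Matrix.Norms.L2Operator
open Classical

variable {G : Type*} (Γ : WeightedGraph G)

theorem pairMeasure_comm (i j : G) : Γ.pairMeasure i j = Γ.pairMeasure j i := by
  rw [pairMeasure, pairMeasure]
  have h : (delta j - delta i : lp (fun _ : G => ℂ) 2) = -(delta i - delta j) := by abel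
  simp only [add_comm (delta j) (delta i), h, spectralMeasure_neg]

theorem isHermitian_B (P : ℕ) (S : Finset G) : (Γ.B P S).IsHermitian := by
  rw [Matrix.IsHermitian, Matrix.conjTranspose_eq_transpose_of_trivial]
  ext i j
  simp only [B, Matrix.transpose_apply, Matrix.of_apply]
  rw [SimpleGraph.edist_comm, Γ.pairMeasure_comm j i]

theorem isHermitian_Qmat (P : ℕ) (S : Finset G) (h : ℝ → ℝ) : (Γ.Qmat P S h).IsHermitian := by
  have h1 := Γ.isHermitian_B P S
  have h2 := Γ.isHermitian_Kmat S h
  ext i j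
  simp only [Qmat, Matrix.conjTranspose_apply, Matrix.hadamard_apply, star_trivial]
  rw [← h1.apply i j, ← h2.apply i j]
  simp

/-- Stated with walks so that induction can strip the first edge: at most D neighbours, at most N
endpoints from each, and 1 for the trivial walk. -/
theorem exists_ncard_walk_le (P : ℕ) : ∃ N : ℕ, ∀ i,
    {j | ∃ p : Γ.graph.Walk i j, p.length ≤ P}.Finite ∧
      {j | ∃ p : Γ.graph.Walk i j, p.length ≤ P}.ncard ≤ N := by
  induction P with
  | zero =>
    refine ⟨1, fun i => ?_⟩
    have : {j | ∃ p : Γ.graph.Walk i j, p.length ≤ 0} ⊆ {i} := by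
      rintro j ⟨p, hp⟩
      exact (SimpleGraph.Walk.eq_of_length_eq_zero (Nat.le_zero.1 hp)).symm
    exact ⟨(Set.finite_singleton i).subset this,
      (Set.ncard_le_ncard this).trans (Set.ncard_singleton i).le⟩
  | succ P ih =>
    obtain ⟨N, hN⟩ := ih
    obtain ⟨D, hD⟩ := Γ.bddAbove_degree
    refine ⟨D * N + 1, fun i => ?_⟩
    set T : Finset G := (Γ.finite_neighbors i).toFinset with hT
    have hTD : T.card ≤ D := by
      rw [hT, ← Set.ncard_eq_toFinset_card _ (Γ.finite_neighbors i)]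
      exact hD ⟨i, rfl⟩
    let U : Finset G := insert i (T.biUnion fun k => (hN k).1.toFinset)
    have hsub : {j | ∃ p : Γ.graph.Walk i j, p.length ≤ P + 1} ⊆ (U : Set G) := by
      rintro j ⟨p, hp⟩
      cases p with
      | nil => simp [U]
      | @cons _ k _ hadj p =>
        have hk : k ∈ T := by simpa [hT] using hadj.2
        refine Finset.mem_coe.2 (Finset.mem_insert_of_mem (Finset.mem_biUnion.2 ⟨k, hk, ?_⟩))
        rw [Set.Finite.mem_toFinset]
        exact ⟨p, by simpa using hp⟩
    refine ⟨U.finite_toSet.subset hsub, (Set.ncard_le_ncard hsub U.finite_toSet).trans ?_⟩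
    rw [Set.ncard_coe_finset]
    refine (Finset.card_insert_le _ _).trans (Nat.succ_le_succ ?_)
    refine (Finset.card_biUnion_le_card_mul _ _ N fun k _ => ?_).trans (Nat.mul_le_mul_right N hTD)
    rw [← Set.ncard_eq_toFinset_card _ (hN k).1]
    exact (hN k).2

theorem exists_card_edist_le (P : ℕ) : ∃ N : ℕ, ∀ (S : Finset G) (i : S),
    (Finset.univ.filter fun j : S => Γ.graph.edist i j ≤ P).card ≤ N := by
  obtain ⟨N, hN⟩ := Γ.exists_ncard_walk_le P
  refine ⟨N, fun S i => le_trans ?_ (hN i).2⟩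
  rw [← Finset.card_map (Function.Embedding.subtype _), ← Set.ncard_coe_finset]
  refine Set.ncard_le_ncard ?_ (hN i).1
  intro j hj
  simp only [Finset.coe_map, Set.mem_image, Finset.mem_coe, Finset.mem_filter] at hj
  obtain ⟨k, ⟨-, hk⟩, rfl⟩ := hj
  obtain ⟨p, hp⟩ := SimpleGraph.exists_walk_of_edist_ne_top
    (ne_top_of_le_ne_top (ENat.natCast_ne_top P) hk)
  exact ⟨p, by rw [← hp] at hk; exact_mod_cast hk⟩

theorem abs_K_le {h : ℝ → ℝ} {C : ℝ} (hC : 0 ≤ C) (hhC : ∀ x ∈ Γ.Sp, |h x| ≤ C) (i j : G) :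
    |Γ.K h i j| ≤ C := by
  rw [K, inner_delta]
  refine (Complex.abs_re_le_norm _).trans ((norm_apply_le _ _ i).trans ?_)
  rw [norm_delta, mul_one]
  exact norm_operatorFunction_le_of_forall hC hhC

theorem Qmat_sub (P : ℕ) (S : Finset G) {g h : ℝ → ℝ} (hg : ContinuousOn g Γ.Sp)
    (hh : ContinuousOn h Γ.Sp) :
    Γ.Qmat P S (fun x => g x - h x) = Γ.Qmat P S g - Γ.Qmat P S h := by
  rw [Qmat, Γ.Kmat_sub S hg hh]
  ext i j
  simp [Qmat, mul_sub]

/-- Since `B` equals 1 beyond distance P, each row has at most N nonzero entries, each bounded by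
uC; Schur's test concludes. -/
theorem norm_Qmat_sub_Kmat_le {P : ℕ} {N : ℕ}
    (hN : ∀ (S : Finset G) (i : S), (Finset.univ.filter fun j : S => Γ.graph.edist i j ≤ P).card ≤ N)
    {S : Finset G} {u : ℝ} (hu : 0 ≤ u) (hB : ∀ i j : S, |Γ.B P S i j - 1| ≤ u)
    {h : ℝ → ℝ} {C : ℝ} (hC : 0 ≤ C) (hhC : ∀ x ∈ Γ.Sp, |h x| ≤ C) :
    ‖Γ.Qmat P S h - Γ.Kmat S h‖ ≤ u * N * C := by
  have hentry : ∀ i j : S, |(Γ.Qmat P S h - Γ.Kmat S h) i j| ≤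
      if Γ.graph.edist i j ≤ P then u * C else 0 := fun i j => by
    have e : (Γ.Qmat P S h - Γ.Kmat S h) i j = (Γ.B P S i j - 1) * Γ.K h i j := by
      simp [Qmat, Kmat_apply, sub_mul]
    rw [e, abs_mul]
    split_ifs with hd
    · exact mul_le_mul (hB i j) (Γ.abs_K_le hC hhC i j) (abs_nonneg _) hu
    · have : Γ.B P S i j = 1 := by simp [B, hd]
      simp [this]
  have hrow : ∀ i : S, ∑ j, |(Γ.Qmat P S h - Γ.Kmat S h) i j| ≤ u * N * C := fun i => by
    refine (Finset.sum_le_sum fun j _ => hentry i j).trans ?_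
    rw [← Finset.sum_filter, Finset.sum_const, nsmul_eq_mul]
    have : ((Finset.univ.filter fun j : S => Γ.graph.edist i j ≤ P).card : ℝ) ≤ N := by
      exact_mod_cast hN S i
    calc _ ≤ (N : ℝ) * (u * C) := by gcongr
      _ = _ := by ring
  refine Matrix.l2_opNorm_le_of_sum_abs_le (by positivity) hrow fun j => ?_
  have hsymm := (Γ.isHermitian_Qmat P S h).sub (Γ.isHermitian_Kmat S h)
  refine le_trans (le_of_eq (Finset.sum_congr rfl fun i _ => ?_)) (hrow j)
  rw [← hsymm.apply j i, star_trivial]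

theorem norm_Qmat_le {P : ℕ} {N : ℕ}
    (hN : ∀ (S : Finset G) (i : S), (Finset.univ.filter fun j : S => Γ.graph.edist i j ≤ P).card ≤ N)
    {S : Finset G} {u : ℝ} (hu : 0 ≤ u) (hB : ∀ i j : S, |Γ.B P S i j - 1| ≤ u)
    {h : ℝ → ℝ} (hh : ContinuousOn h Γ.Sp) {C : ℝ} (hC : 0 ≤ C) (hhC : ∀ x ∈ Γ.Sp, |h x| ≤ C) :
    ‖Γ.Qmat P S h‖ ≤ (u * N + 1) * C := by
  have h1 := Γ.norm_Qmat_sub_Kmat_le hN hu hB hC hhC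
  have h2 := Γ.norm_Kmat_le S hh hC hhC
  have h3 := norm_add_le (Γ.Qmat P S h - Γ.Kmat S h) (Γ.Kmat S h)
  rw [sub_add_cancel] at h3
  linarith

/-! ### Lipschitz estimates in the parameter -/

section Lipschitz

variable {Γ} {ρ η : ℝ} {f g : ℝ → ℝ}

theorem LogClose.norm_Kmat_sub_le (hfg : Γ.LogClose η f g) (hη : 0 < η) (hf : Γ.MemFρ ρ f)
    (hg : Γ.MemFρ ρ g) (S : Finset G) : ‖Γ.Kmat S f - Γ.Kmat S g‖ ≤ Real.exp ρ * η :=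
  Γ.norm_Kmat_sub_le S hf.continuousOn hg.continuousOn (by positivity) fun _ hx =>
    hfg.abs_sub_le hf hg hx

/-- One factor e^ρ comes from the Lipschitz bound on f = exp(log f), and one from each of the two
inverses. -/
theorem LogClose.norm_Kmat_inv_sub_le (hfg : Γ.LogClose η f g) (hη : 0 < η) (hf : Γ.MemFρ ρ f)
    (hg : Γ.MemFρ ρ g) (S : Finset G) :
    ‖(Γ.Kmat S f)⁻¹ - (Γ.Kmat S g)⁻¹‖ ≤ Real.exp ρ ^ 3 * η := by
  refine (Matrix.norm_inv_sub_inv_le (Γ.isHermitian_Kmat S f) (Γ.isHermitian_Kmat S g)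
    (Real.exp_pos (-ρ)) (Γ.le_dotProduct_Kmat S hf.continuousOn fun x hx => hf.exp_neg_le hx)
    (Γ.le_dotProduct_Kmat S hg.continuousOn fun x hx => hg.exp_neg_le hx)).trans ?_
  rw [Real.exp_neg, inv_inv]
  calc _ ≤ Real.exp ρ * (Real.exp ρ * η) * Real.exp ρ := by
        gcongr
        exact hfg.norm_Kmat_sub_le hη hf hg S
    _ = _ := by ring

theorem LogClose.abs_log_det_sub_le (hfg : Γ.LogClose η f g) (hη : 0 < η) (hf : Γ.MemFρ ρ f)
    (hg : Γ.MemFρ ρ g) (S : Finset G) :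
    |Real.log (Γ.Kmat S f).det - Real.log (Γ.Kmat S g).det| ≤ S.card * (Real.exp ρ ^ 2 * η) := by
  refine (Matrix.abs_log_det_sub_log_det_le (Γ.isHermitian_Kmat S f) (Γ.isHermitian_Kmat S g)
    (Real.exp_pos (-ρ)) (Γ.le_dotProduct_Kmat S hf.continuousOn fun x hx => hf.exp_neg_le hx)
    (Γ.le_dotProduct_Kmat S hg.continuousOn fun x hx => hg.exp_neg_le hx)).trans ?_
  rw [Real.exp_neg, inv_inv, Fintype.card_coe]
  refine mul_le_mul_of_nonneg_left ?_ (Nat.cast_nonneg _)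
  calc _ ≤ Real.exp ρ * (Real.exp ρ * η) := by
        gcongr
        exact hfg.norm_Kmat_sub_le hη hf hg S
    _ = _ := by ring

theorem LogClose.abs_integral_log_sub_le {V : ℕ → Finset G} {μ : FiniteMeasure ℝ}
    (hμ : Tendsto (fun n => Γ.avgMeasure (V n)) atTop (𝓝 μ)) (hfg : Γ.LogClose η f g)
    (hf : Γ.MemFρ ρ f) (hg : Γ.MemFρ ρ g) :
    |∫ x, Real.log (f x) ∂(μ : Measure ℝ) - ∫ x, Real.log (g x) ∂(μ : Measure ℝ)| ≤
      (μ : Measure ℝ).real Set.univ * η := by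
  rw [← integral_sub (integrable_of_continuousOn_Sp hμ hf.continuousOn_log)
    (integrable_of_continuousOn_Sp hμ hg.continuousOn_log), ← Real.norm_eq_abs, mul_comm]
  refine norm_integral_le_of_norm_le_const ?_
  filter_upwards [ae_mem_Sp hμ] with x hx using hfg x hx

end Lipschitz

end WeightedGraph

end

/-! ### Consistency of the four estimators. -/

theorem mainTheorem1 {G : Type*} [Countable G] (Γ : WeightedGraph G)
    -- growing nested finite sets of vertices with small boundary
    (V : ℕ → Finset G) (hV : Monotone V)
    (hcard : Tendsto (fun n => (V n).card) atTop atTop)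
    (hboundary : (fun n => (Γ.boundaryCard (V n) : ℝ)) =o[atTop] fun n => ((V n).card : ℝ))
    -- the spectral measure
    (μ : FiniteMeasure ℝ) (hμ : Tendsto (fun n => Γ.avgMeasure (V n)) atTop (𝓝 μ))
    -- the parametric family of spectral densities
    (a b : ℝ) (ρ : ℝ) (hρ : 0 < ρ) (f : ℝ → ℝ → ℝ)
    (hinj : ∀ θ ∈ Set.Icc a b, ∀ θ' ∈ Set.Icc a b, f θ =ᵐ[(μ : Measure ℝ)] f θ' → θ = θ')
    (hcont : ∀ x ∈ Γ.Sp, ContinuousOn (fun θ => f θ x) (Set.Icc a b))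
    (hreg : ∀ θ ∈ Set.Icc a b, Γ.MemFρ ρ (f θ))
    (θ₀ : ℝ) (hθ₀ : θ₀ ∈ interior (Set.Icc a b))
    -- the centered Gaussian process with spectral density `f θ₀`
    {Ω : Type*} [MeasurableSpace Ω] (Pr : Measure Ω) [IsProbabilityMeasure Pr]
    (X : G → Ω → ℝ) (hX : IsGaussianProcess X Pr) (hX0 : ∀ i, ∫ ω, X i ω ∂Pr = 0)
    (hXcov : ∀ i j, cov[X i, X j; Pr] = Γ.K (f θ₀) i j) :
    MaximizersConverge Pr (Set.Icc a b) θ₀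
        (fun n θ ω => Γ.logLik (V n) (f θ) (fun i => X i ω)) ∧
      MaximizersConverge Pr (Set.Icc a b) θ₀
        (fun n θ ω => Γ.logLikBar μ (V n) (f θ) (fun i => X i ω)) ∧
      MaximizersConverge Pr (Set.Icc a b) θ₀
        (fun n θ ω => Γ.logLikTilde μ (V n) (f θ) (fun i => X i ω)) ∧
      ∀ P : ℕ, 0 < P →
        (∃ u : ℕ → ℝ, (∀ n, 0 < u n) ∧ Tendsto u atTop (𝓝 0) ∧
          ∀ n, ∀ i j : V n, |Γ.B P (V n) i j - 1| ≤ u n) →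
        MaximizersConverge Pr (Set.Icc a b) θ₀
          (fun n θ ω => Γ.logLikUnb μ P (V n) (f θ) (fun i => X i ω)) := by

  classical
  open scoped Matrix.Norms.L2Operator in
  have hθ₀' : θ₀ ∈ Set.Icc a b := interior_subset hθ₀
  have hΘ : IsCompact (Set.Icc a b) := isCompact_Icc
  have hf₀ := hreg θ₀ hθ₀'
  have hE := Real.exp_pos ρ
  have hE1 : 1 ≤ Real.exp ρ := Real.one_le_exp hρ.le
  set M : ℝ := (μ : Measure ℝ).real Set.univ with hM
  have hM0 : 0 ≤ M := measureReal_nonneg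
  have hclose : ∀ η > 0, ∃ δ > 0, ∀ θ ∈ Set.Icc a b, ∀ θ' ∈ Set.Icc a b, |θ - θ'| < δ →
      Γ.LogClose η (f θ) (f θ') := fun η hη => Γ.exists_delta_logClose hΘ hcont hreg hη
  have hpos : ∀ S, (Γ.Kmat S (f θ₀)).PosDef := fun S =>
    Matrix.posDef_of_le (Γ.isHermitian_Kmat S _) (Real.exp_pos (-ρ))
      (Γ.le_dotProduct_Kmat S hf₀.continuousOn fun x hx => hf₀.exp_neg_le hx)
  have hC' : ∀ S, ‖Γ.Kmat S (f θ₀)‖ ≤ Real.exp ρ := fun S =>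
    Γ.norm_Kmat_le S hf₀.continuousOn hE.le fun x hx => hf₀.abs_le_exp hx
  have hcov : ∀ (S : Finset G) (i j : S), cov[X i, X j; Pr] = Γ.Kmat S (f θ₀) i j :=
    fun S i j => hXcov i j
  have hmin : ∀ θ ∈ Set.Icc a b, θ ≠ θ₀ →
      ∫ x, Real.log (f θ₀ x) ∂(μ : Measure ℝ) + ∫ x, 1 / f θ₀ x * f θ₀ x ∂(μ : Measure ℝ) <
        ∫ x, Real.log (f θ x) ∂(μ : Measure ℝ) + ∫ x, 1 / f θ x * f θ₀ x ∂(μ : Measure ℝ) :=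
    fun θ hθ hne => WeightedGraph.contrast_lt hμ hf₀ (hreg θ hθ)
      fun h => hne (hinj θ hθ θ₀ hθ₀' h)
  have hinvC : ∀ n, ∀ θ ∈ Set.Icc a b, ‖(Γ.Kmat (V n) (f θ))⁻¹‖ ≤ Real.exp ρ := fun n θ hθ => by
    have := Matrix.norm_inv_le (Γ.isHermitian_Kmat (V n) (f θ)) (Real.exp_pos (-ρ))
      (Γ.le_dotProduct_Kmat (V n) (hreg θ hθ).continuousOn fun x hx => (hreg θ hθ).exp_neg_le hx)
    rwa [Real.exp_neg, inv_inv] at this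
  have hinvlim : ∀ θ ∈ Set.Icc a b, Tendsto (fun n =>
      ((Γ.Kmat (V n) (f θ))⁻¹ * Γ.Kmat (V n) (f θ₀)).trace / (V n).card) atTop
        (𝓝 (∫ x, 1 / f θ x * f θ₀ x ∂(μ : Measure ℝ))) := fun θ hθ =>
    WeightedGraph.tendsto_trace_Kmat_inv_mul hcard hboundary hμ (hreg θ hθ).continuousOn
      (Real.exp_pos (-ρ)) (fun x hx => (hreg θ hθ).exp_neg_le hx) hf₀.continuousOn
  have hKlim : ∀ θ ∈ Set.Icc a b, Tendsto (fun n =>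
      (Γ.Kmat (V n) (fun x => 1 / f θ x) * Γ.Kmat (V n) (f θ₀)).trace / (V n).card) atTop
        (𝓝 (∫ x, 1 / f θ x * f θ₀ x ∂(μ : Measure ℝ))) := fun θ hθ =>
    WeightedGraph.tendsto_trace_Kmat_mul hcard hboundary hμ (hreg θ hθ).continuousOn_inv
      hf₀.continuousOn
  have hDint : ∀ θ ∈ Set.Icc a b, Tendsto (fun n =>
      ((V n).card * ∫ t, Real.log (f θ t) ∂(μ : Measure ℝ)) / (V n).card) atTop
        (𝓝 (∫ t, Real.log (f θ t) ∂(μ : Measure ℝ))) := fun θ _ => by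
    refine tendsto_const_nhds.congr' ?_
    filter_upwards [hcard.eventually_gt_atTop 0] with n hn
    have : ((V n).card : ℝ) ≠ 0 := by exact_mod_cast hn.ne'
    field_simp
  have hDintlip : ∀ κ, M ≤ κ → ∀ n, ∀ θ ∈ Set.Icc a b, ∀ θ' ∈ Set.Icc a b, ∀ η > 0,
      Γ.LogClose η (f θ) (f θ') →
      |(V n).card * ∫ t, Real.log (f θ t) ∂(μ : Measure ℝ) -
        (V n).card * ∫ t, Real.log (f θ' t) ∂(μ : Measure ℝ)| ≤ (V n).card * (κ * η) := by
    intro κ hκ n θ hθ θ' hθ' η hη hc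
    rw [← mul_sub, abs_mul, Nat.abs_cast]
    refine mul_le_mul_of_nonneg_left ?_ (Nat.cast_nonneg _)
    exact (hc.abs_integral_log_sub_le hμ (hreg θ hθ) (hreg θ' hθ')).trans
      (mul_le_mul_of_nonneg_right hκ hη.le)
  -- In each case κ dominates the Lipschitz constants, in terms of log f_θ, of both the logarithmic
  -- part and the matrix of the quadratic form.
  refine ⟨?_, ?_, ?_, fun P _ ⟨u, hu0, hu, hB⟩ => ?_⟩
  · exact WeightedGraph.maximizersConverge_of_quadratic (Γ := Γ) (f := f) hV hcard hΘ hθ₀' hclose hX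
      hX0 hcov hpos hC'
      (D := fun S θ => Real.log (Γ.Kmat S (f θ)).det) (A := fun S θ => (Γ.Kmat S (f θ))⁻¹)
      (κ := Real.exp ρ ^ 3) (by positivity)
      (fun n θ hθ θ' hθ' η hη hc =>
        (hc.abs_log_det_sub_le hη (hreg θ hθ) (hreg θ' hθ') (V n)).trans <| by
          refine mul_le_mul_of_nonneg_left (mul_le_mul_of_nonneg_right ?_ hη.le) (Nat.cast_nonneg _)
          exact pow_le_pow_right₀ hE1 (by norm_num))
      (fun n θ hθ θ' hθ' η hη hc => hc.norm_Kmat_inv_sub_le hη (hreg θ hθ) (hreg θ' hθ') (V n))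
      (fun n θ hθ => (Γ.isHermitian_Kmat (V n) (f θ)).inv) hinvC
      (fun θ hθ => WeightedGraph.tendsto_log_det_Kmat hcard hboundary hμ (hreg θ hθ).continuousOn
        (Real.exp_pos (-ρ)) hE.le (fun x hx => (hreg θ hθ).exp_neg_le hx)
        fun x hx => (hreg θ hθ).le_exp hx)
      hinvlim hmin
  · exact WeightedGraph.maximizersConverge_of_quadratic (Γ := Γ) (f := f) hV hcard hΘ hθ₀' hclose hX
      hX0 hcov hpos hC'
      (D := fun S θ => S.card * ∫ t, Real.log (f θ t) ∂(μ : Measure ℝ))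
      (A := fun S θ => (Γ.Kmat S (f θ))⁻¹) (κ := M + Real.exp ρ ^ 3) (by positivity)
      (hDintlip _ (by linarith [pow_pos hE 3]))
      (fun n θ hθ θ' hθ' η hη hc =>
        (hc.norm_Kmat_inv_sub_le hη (hreg θ hθ) (hreg θ' hθ') (V n)).trans
          (mul_le_mul_of_nonneg_right (by linarith) hη.le))
      (fun n θ hθ => (Γ.isHermitian_Kmat (V n) (f θ)).inv) hinvC hDint hinvlim hmin
  · exact WeightedGraph.maximizersConverge_of_quadratic (Γ := Γ) (f := f) hV hcard hΘ hθ₀' hclose hX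
      hX0 hcov hpos hC'
      (D := fun S θ => S.card * ∫ t, Real.log (f θ t) ∂(μ : Measure ℝ))
      (A := fun S θ => Γ.Kmat S fun t => 1 / f θ t) (κ := M + Real.exp ρ) (by positivity)
      (hDintlip _ (by linarith))
      (fun n θ hθ θ' hθ' η hη hc =>
        (Γ.norm_Kmat_sub_le (V n) (hreg θ hθ).continuousOn_inv (hreg θ' hθ').continuousOn_inv
          (by positivity) fun x hx => hc.abs_inv_sub_inv_le (hreg θ hθ) (hreg θ' hθ') hx).trans
          (mul_le_mul_of_nonneg_right (by linarith) hη.le))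
      (fun n θ hθ => Γ.isHermitian_Kmat (V n) _)
      (fun n θ hθ => Γ.norm_Kmat_le (V n) (hreg θ hθ).continuousOn_inv hE.le
        fun x hx => (hreg θ hθ).abs_inv_le_exp hx) hDint hKlim hmin
  · obtain ⟨N, hN⟩ := Γ.exists_card_edist_le P
    -- The uniform bound U serves for norms and Lipschitz constants; u_n itself is only needed for
    -- the limit of the trace.
    obtain ⟨U, hU⟩ := hu.bddAbove_range
    have hU : ∀ n, u n ≤ U := fun n => hU ⟨n, rfl⟩
    have hU0 : 0 ≤ U := (hu0 0).le.trans (hU 0)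
    have hBU : ∀ n, ∀ i j : V n, |Γ.B P (V n) i j - 1| ≤ U := fun n i j => (hB n i j).trans (hU n)
    refine WeightedGraph.maximizersConverge_of_quadratic (Γ := Γ) (f := f) hV hcard hΘ hθ₀' hclose hX
      hX0 hcov hpos hC'
      (D := fun S θ => S.card * ∫ t, Real.log (f θ t) ∂(μ : Measure ℝ))
      (A := fun S θ => Γ.Qmat P S fun t => 1 / f θ t)
      (e := fun θ => ∫ x, 1 / f θ x * f θ₀ x ∂(μ : Measure ℝ))
      (κ := M + (U * N + 1) * Real.exp ρ) (by positivity)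
      (hDintlip _ (by linarith [mul_nonneg (by positivity : 0 ≤ U * N + 1) hE.le]))
      (fun n θ hθ θ' hθ' η hη hc => ?_)
      (fun n θ hθ => Γ.isHermitian_Qmat P (V n) _)
      (fun n θ hθ => Γ.norm_Qmat_le hN hU0 (hBU n) (hreg θ hθ).continuousOn_inv hE.le
        fun x hx => (hreg θ hθ).abs_inv_le_exp hx) hDint (fun θ hθ => ?_) hmin
    · rw [← Γ.Qmat_sub P (V n) (hreg θ hθ).continuousOn_inv (hreg θ' hθ').continuousOn_inv]
      refine (Γ.norm_Qmat_le hN hU0 (hBU n)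
        ((hreg θ hθ).continuousOn_inv.sub (hreg θ' hθ').continuousOn_inv)
        (C := Real.exp ρ * η) (by positivity)
        fun x hx => hc.abs_inv_sub_inv_le (hreg θ hθ) (hreg θ' hθ') hx).trans ?_
      rw [← mul_assoc]
      exact mul_le_mul_of_nonneg_right (by linarith) hη.le
    -- Tapering changes the normalized trace by at most u_n N e^(2ρ), so the limit is that of the
    -- untapered matrices.
    · have hsmall : Tendsto (fun n => ((Γ.Qmat P (V n) (fun x => 1 / f θ x) -
          Γ.Kmat (V n) (fun x => 1 / f θ x)) * Γ.Kmat (V n) (f θ₀)).trace / (V n).card)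
          atTop (𝓝 0) := by
        have hlim : Tendsto (fun n => u n * (N * Real.exp ρ * Real.exp ρ)) atTop (𝓝 0) := by
          simpa using hu.mul_const (N * Real.exp ρ * Real.exp ρ)
        refine squeeze_zero_norm' ?_ hlim
        filter_upwards [hcard.eventually_gt_atTop 0] with n hn
        have hn' : (0 : ℝ) < (V n).card := by exact_mod_cast hn
        rw [Real.norm_eq_abs, abs_div, abs_of_pos hn', div_le_iff₀ hn']
        refine (Matrix.abs_trace_le_card_mul_norm _).trans ?_
        rw [Fintype.card_coe, mul_comm]
        refine mul_le_mul_of_nonneg_right ((norm_mul_le _ _).trans ?_) hn'.le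
        calc _ ≤ u n * N * Real.exp ρ * Real.exp ρ :=
              mul_le_mul (Γ.norm_Qmat_sub_Kmat_le hN (hu0 n).le (hB n) hE.le
                fun x hx => (hreg θ hθ).abs_inv_le_exp hx) (hC' _) (norm_nonneg _)
                (by have := hu0 n; positivity)
          _ = _ := by ring
      have := hsmall.add (hKlim θ hθ)
      rw [zero_add] at this
      refine this.congr fun n => ?_
      rw [sub_mul, Matrix.trace_sub]
      ring
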